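/- Let $D$ be an oriented link diagram on the sphere. \emph{Homogeneous diagrams.} The Seifert graph of $D$ has a vertex for each Seifert circle and an edge for each crossing, which joins the two Seifert circles at that crossing and carries the sign of the oriented crossing. $D$ is homogeneous if in each block of its Seifert graph (maximal connected subgraph without cut vertex) all edges have the same sign. \emph{Alternative diagrams.} The graph $\Phi(D)$ has a vertex for each region of $D$ and, for each crossing, a directed edge from the region between the two incoming strands to the region between the two outgoing strands, carrying the sign of the oriented crossing. $D$ is alternative if no walk in $\Phi(D)$ contains both positive and negative edges. \emph{Tangles.} An unoriented crossing drawn with end points NE, NW, SW, SE has plane sign $+1$ if its over-strand joins SW and NE, and $-1$ otherwise. The standard diagram of the rational tangle $[\varepsilon a_1,\dots,\varepsilon a_n]$ ($\varepsilon=\pm1$, $n\ge 1$, $a_i\ge 1$) consists of alternating rows and columns of twists, the $i$-th having $a_i$ crossings, the $(i+1)$-st attached to the tangle formed by the first $i$; all its crossings have plane sign $\varepsilon$. A block of rational tangles is a finite expression in sums (side by side) and products (one on top of the other) of rational tangles. It extends a crossing of plane sign $\varepsilon$ if the denominators of all its rational tangles have the sign $\varepsilon$. Let $c$ be a crossing of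 $D$, with its four ends labelled NE, NW, SW, SE in one of the four possible ways in counterclockwise order, and let $b$ be a block of rational tangles that extends $c$, with an orientation that agrees at the four end points with that of $D\setminus c$. Let $D^*$ be the oriented diagram obtained from $D$ by replacing $c$ by $b$. Then: 1. $D$ is homogeneous if and only if $D^*$ is homogeneous. 2. If $D^*$ is alternative, then $D$ is alternative. 3. If all crossings of the oriented block $b$ have the same sign, as oriented crossings, as $c$, then $D$ is alternative if and only if $D^*$ is alternative. -/

import Mathlib

/-! ## Oriented link diagrams -/

/-- An oriented link diagram, as a 4-valent map with over/under information.
The four ends of the strands at a crossing `x` are `(x, 0), (x, 1), (x, 2), (x, 3)` in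
counterclockwise order, so that `(x, i)` and `(x, i + 2)` lie on the same strand; the arcs of the
diagram are the pairs `{e, glue e}`.  The corner `(x, i)` is the one between the ends `i` and
`i + 1`, and `region (x, i)` is the complementary region that contains it.  The components of the
diagram without crossings are the members of `Loop`; each separates the two regions
`loopLeft` and `loopRight`. -/
structure OrientedDiagram where
  /-- the crossings -/
  Crossing : Type
  /-- the simple closed components without crossings -/
  Loop : Type
  /-- the regions of the complement of the diagram -/
  Region : Type
  finite_crossing : Finite Crossing
  finite_loop : Finite Loop
  finite_region : Finite Region
  /-- the other end of the arc that starts at a given end -/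
  glue : Crossing × Fin 4 → Crossing × Fin 4
  glue_glue : ∀ e, glue (glue e) = e
  /-- whether the strand through the given end is the over-strand of the crossing -/
  isOver : Crossing × Fin 4 → Bool
  isOver_succ : ∀ x i, isOver (x, i + 1) = !isOver (x, i)
  /-- whether the orientation points away from the crossing at the given end -/
  out : Crossing × Fin 4 → Bool
  out_opposite : ∀ x i, out (x, i + 2) = !out (x, i)
  out_glue : ∀ e, out (glue e) = !out e
  /-- the region at the corner between the ends `i` and `i + 1` of `x` -/
  region : Crossing × Fin 4 → Region
  /-- the left side of an arc, seen from either of its two crossings, is in one region -/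
  region_glue : ∀ e, region ((glue e).1, (glue e).2 - 1) = region e
  loopLeft : Loop → Region
  loopRight : Loop → Region

namespace OrientedDiagram

variable (D : OrientedDiagram)

/-- The connected components of the diagram that have crossings. -/
def Component : Type := Quot fun x y : D.Crossing => ∃ i, (D.glue (x, i)).1 = y

/-- Two regions touch the same connected component of the diagram. -/
def TouchSame (r s : D.Region) : Prop :=
  (∃ x y i j, (Quot.mk _ x : D.Component) = Quot.mk _ y ∧ D.region (x, i) = r ∧
    D.region (y, j) = s) ∨
  ∃ l, D.loopLeft l = r ∧ D.loopRight l = s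

/-- The diagram lies on the sphere.  With `n` crossings and `2n` edges, Euler's formula for a map
with `k` connected components reads `n - 2n + (number of regions) = k + 1`. -/
def IsPlanar : Prop :=
  (∀ r s, Relation.EqvGen D.TouchSame r s) ∧
  Nat.card D.Region = Nat.card D.Component + Nat.card D.Loop + Nat.card D.Crossing + 1

/-- The corner of `x` between the two ends at which the strands leave `x`; the opposite corner,
`outCorner x + 2`, is the one between the two ends at which they arrive. -/
def outCorner (x : D.Crossing) : Fin 4 :=
  if D.out (x, 0) then (if D.out (x, 1) then 0 else 3) else (if D.out (x, 1) then 1 else 2)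

/-- A crossing is positive if a counterclockwise rotation by less than a straight angle takes the
direction of the over-strand to the direction of the under-strand. -/
def IsPositive (x : D.Crossing) : Prop := D.isOver (x, D.outCorner x) = true

/-! ### The Seifert graph and homogeneity -/

/-- Ends joined by an arc of the diagram, or by the oriented smoothing of a crossing (which joins
each outgoing end to the incoming end next to it). -/
def SeifertStep (e f : D.Crossing × Fin 4) : Prop :=
  f = D.glue e ∨ (f = (e.1, e.2 + 1) ∧ D.out e ≠ D.out f)

/-- The Seifert circles. -/
def SeifertCircle : Type := Quot D.SeifertStep ⊕ D.Loop

/-- The Seifert circle through a given end. -/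
def seifertCircle (e : D.Crossing × Fin 4) : D.SeifertCircle := Sum.inl (Quot.mk _ e)

/-- The two Seifert circles that pass a crossing: each contains one of its two outgoing ends. -/
def seifertEnds (x : D.Crossing) : Sym2 D.SeifertCircle :=
  s(D.seifertCircle (x, D.outCorner x), D.seifertCircle (x, D.outCorner x + 1))

/-- The Seifert graph: a vertex for each Seifert circle, an edge for each crossing. -/
def seifertGraph : Graph D.SeifertCircle D.Crossing where
  vertexSet := Set.univ
  IsLink x u v := D.seifertEnds x = s(u, v)
  edgeSet := Set.univ
  isLink_symm x _ := ⟨fun u v h => by rw [h, Sym2.eq_swap]⟩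
  eq_or_eq_of_isLink_of_isLink x u v w z h h' := by
    rw [h, Sym2.eq_iff] at h'
    rcases h' with h' | h'
    · exact Or.inl h'.1
    · exact Or.inr h'.1
  edge_mem_iff_exists_isLink x := by
    refine ⟨fun _ => ⟨_, _, rfl⟩, fun _ => Set.mem_univ _⟩
  left_mem_of_isLink _ _ _ _ := Set.mem_univ _

end OrientedDiagram

namespace GraphBlock

variable {α β : Type} (G : Graph α β)

/-- The vertices that two sets of edges have in common. -/
def commonVertices (A B : Set β) : Set α :=
  {v | (∃ e ∈ A, G.Inc e v) ∧ ∃ e ∈ B, G.Inc e v}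

/-- The subgraph formed by a set of edges is connected. -/
def IsConnected (B : Set β) : Prop :=
  ∀ A ⊆ B, A.Nonempty → (B \ A).Nonempty → (commonVertices G A (B \ A)).Nonempty

/-- The (connected) subgraph formed by the edges in `B` falls apart when it is cut at `v`: its
edges form two nonempty subgraphs that have only `v` in common.  For a connected graph without
loops this says that the removal of `v` increases the number of components. -/
def IsCutVertex (B : Set β) (v : α) : Prop :=
  ∃ A ⊆ B, A.Nonempty ∧ (B \ A).Nonempty ∧ commonVertices G A (B \ A) = {v}

/-- The blocks with at least one edge, given by their edge sets: the maximal connected subgraphs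
without a cut vertex. -/
def IsBlock (B : Set β) : Prop :=
  Maximal (fun B => B ⊆ G.edgeSet ∧ B.Nonempty ∧ IsConnected G B ∧ ∀ v, ¬ IsCutVertex G B v) B

end GraphBlock

namespace OrientedDiagram

variable (D : OrientedDiagram)

/-- All edges in each block of the Seifert graph have the same sign. -/
def IsHomogeneous : Prop :=
  ∀ B, GraphBlock.IsBlock D.seifertGraph B →
    ∀ x ∈ B, ∀ y ∈ B, (D.IsPositive x ↔ D.IsPositive y)

/-! ### The enhanced checkerboard graph and alternativity

Its vertices are the regions.  Each crossing gives a directed edge, with the sign of the crossing,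
from the region between the two incoming ends to the region between the two outgoing ends: these
are the two opposite regions which the oriented smoothing of the crossing merges.  (The colours of
the vertices play no role in the definition of alternativity.) -/

/-- The initial vertex of the edge of the enhanced checkerboard graph given by a crossing. -/
def edgeTail (x : D.Crossing) : D.Region := D.region (x, D.outCorner x + 2)

/-- The terminal vertex of the edge of the enhanced checkerboard graph given by a crossing. -/
def edgeHead (x : D.Crossing) : D.Region := D.region (x, D.outCorner x)

/-- A walk in the enhanced checkerboard graph, as the list of its edges. -/
def IsWalk (w : List D.Crossing) : Prop :=
  w.IsChain fun x y => D.edgeHead x = D.edgeTail y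

/-- No walk in the enhanced checkerboard graph has both positive and negative edges. -/
def IsAlternative : Prop :=
  ∀ w, D.IsWalk w → ∀ x ∈ w, ∀ y ∈ w, (D.IsPositive x ↔ D.IsPositive y)

end OrientedDiagram

/-! ## Tangles -/

/-- An (unoriented) tangle diagram in a disc all of whose four end points are joined to crossings.
The end points are `0 = NE`, `1 = NW`, `2 = SW`, `3 = SE`, in counterclockwise order; the ends at a
crossing are numbered in the same way, `(x, 0)` to the north-east of `x` and so on.
`next e` is the other end of the arc that starts at `e`: it is an end at a crossing or one of the
end points of the tangle; `port k` is the end joined to the end point `k`. -/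
structure Tangle where
  Crossing : Type
  finite_crossing : Finite Crossing
  next : Crossing × Fin 4 → (Crossing × Fin 4) ⊕ Fin 4
  port : Fin 4 → Crossing × Fin 4
  next_port : ∀ k, next (port k) = Sum.inr k
  port_of_next : ∀ e k, next e = Sum.inr k → port k = e
  next_symm : ∀ e f, next e = Sum.inl f → next f = Sum.inl e
  isOver : Crossing × Fin 4 → Bool
  isOver_succ : ∀ x i, isOver (x, i + 1) = !isOver (x, i)

namespace Tangle

/-- The tangle with one crossing, of the given sign (`true` for `1` and `false` for `-1`): the sign
is `1` if the over-strand runs between the end points `NE` and `SW`. -/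
def single (s : Bool) : Tangle where
  Crossing := Unit
  finite_crossing := inferInstance
  next e := Sum.inr e.2
  port k := ((), k)
  next_port _ := rfl
  port_of_next e k h := by cases h; rfl
  next_symm e f h := by cases h
  isOver e := if e.2 = 0 ∨ e.2 = 2 then s else !s
  isOver_succ _ i := by
    have : ∀ (s : Bool) (i : Fin 4), (if i + 1 = 0 ∨ i + 1 = 2 then s else !s) =
        !(if i = 0 ∨ i = 2 then s else !s) := by decide
    exact this s i

/-- Two tangles pasted together: the end point `k` of `A` is joined to the end point `l` of `B`
whenever `f k = some l` (equivalently `g l = some k`). -/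
def paste (A B : Tangle) (f g : Fin 4 → Option (Fin 4))
    (hfg : ∀ k l, f k = some l ↔ g l = some k) (hn : ∀ k, f k = none ↔ g k ≠ none) : Tangle where
  Crossing := A.Crossing ⊕ B.Crossing
  finite_crossing := by
    have := A.finite_crossing
    have := B.finite_crossing
    infer_instance
  next := fun
    | (Sum.inl x, i) => match A.next (x, i) with
      | Sum.inl e => Sum.inl (Sum.inl e.1, e.2)
      | Sum.inr k => match f k with
        | some l => Sum.inl (Sum.inr (B.port l).1, (B.port l).2)
        | none => Sum.inr k
    | (Sum.inr x, i) => match B.next (x, i) with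
      | Sum.inl e => Sum.inl (Sum.inr e.1, e.2)
      | Sum.inr l => match g l with
        | some k => Sum.inl (Sum.inl (A.port k).1, (A.port k).2)
        | none => Sum.inr l
  port k := match f k with
    | none => (Sum.inl (A.port k).1, (A.port k).2)
    | some _ => (Sum.inr (B.port k).1, (B.port k).2)
  next_port k := by
    cases h : f k with
    | none => simp [A.next_port, h]
    | some l =>
      have : g k = none := by
        by_contra h'
        rw [← Ne, ← hn k, h] at h'
        cases h'
      simp [B.next_port, this]
  port_of_next := by
    rintro ⟨x | x, i⟩ k h
    · rcases hA : A.next (x, i) with e | m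
      · simp [hA] at h
      · cases hf : f m with
        | none =>
          simp only [hA, hf, Sum.inr.injEq] at h
          subst h
          simp [hf, A.port_of_next _ _ hA]
        | some l => simp [hA, hf] at h
    · rcases hB : B.next (x, i) with e | m
      · simp [hB] at h
      · cases hg : g m with
        | none =>
          simp only [hB, hg, Sum.inr.injEq] at h
          subst h
          cases hf : f m with
          | none => exact absurd hg ((hn m).1 hf)
          | some l => simp [B.port_of_next _ _ hB]
        | some l => simp [hB, hg] at h
  next_symm := by
    rintro ⟨x | x, i⟩ e h
    · rcases hA : A.next (x, i) with d | m
      · simp only [hA, Sum.inl.injEq] at h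
        subst h
        simp [A.next_symm _ _ hA]
      · cases hf : f m with
        | none => simp [hA, hf] at h
        | some l =>
          simp only [hA, hf, Sum.inl.injEq] at h
          subst h
          simp [B.next_port, (hfg m l).1 hf, A.port_of_next _ _ hA]
    · rcases hB : B.next (x, i) with d | m
      · simp only [hB, Sum.inl.injEq] at h
        subst h
        simp [B.next_symm _ _ hB]
      · cases hg : g m with
        | none => simp [hB, hg] at h
        | some l =>
          simp only [hB, hg, Sum.inl.injEq] at h
          subst h
          simp [A.next_port, (hfg l m).2 hg, B.port_of_next _ _ hB]
  isOver e := Sum.elim (fun x => A.isOver (x, e.2)) (fun x => B.isOver (x, e.2)) e.1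
  isOver_succ x i := by
    rcases x with x | x
    · exact A.isOver_succ x i
    · exact B.isOver_succ x i

/-- The sum `A + B`: `B` is placed to the right of `A`, and the end points `NE`, `SE` of `A` are
joined to the end points `NW`, `SW` of `B`. -/
def sum (A B : Tangle) : Tangle :=
  paste A B ![some 1, none, none, some 2] ![none, some 0, some 3, none] (by decide) (by decide)

/-- The product: `A` is placed on top of `B`, and the end points `SW`, `SE` of `A` are joined to
the end points `NW`, `NE` of `B`. -/
def prod (A B : Tangle) : Tangle :=
  paste A B ![none, none, some 1, some 0] ![some 3, some 2, none, none] (by decide) (by decide)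

/-- The sum (`horizontal`) or product of two tangles. -/
def join (horizontal : Bool) (A B : Tangle) : Tangle := if horizontal then sum A B else prod A B

/-- A row (`horizontal`) or column of `n + 1` crossings of sign `s`. -/
def twist (horizontal s : Bool) : ℕ → Tangle
  | 0 => single s
  | n + 1 => join horizontal (twist horizontal s n) (single s)

/-- Attach further boxes to a tangle, alternately rows (to the right or to the left) and columns
(below or above).  A box `(a, after)` has `a` crossings; it is attached to the right or below if
`after` is true, and to the left or above otherwise. -/
def addBoxes (s : Bool) : Bool → Tangle → List (ℕ+ × Bool) → Tangle
  | _, T, [] => T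
  | horizontal, T, (a, after) :: l =>
    let W := twist horizontal s (a.natPred)
    addBoxes s (!horizontal) (if after then join horizontal T W else join horizontal W T) l

/-- The standard diagram of the rational tangle with continued fraction `[± a₁, …, ± aₙ]`, whose
denominators all have the sign `s` (`true` for `1`, `false` for `-1`).  The boxes are alternately
rows and columns; `horizontal` tells whether the first is a row.  (Drawn in the form in which all
boxes are rows, every second box is turned by a right angle, and the signs of its crossings in the
picture change.) -/
def rational (s horizontal : Bool) (a₁ : ℕ+) (l : List (ℕ+ × Bool)) : Tangle :=
  addBoxes s (!horizontal) (twist horizontal s a₁.natPred) l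

/-- An orientation of (the strands of) a tangle diagram: `out e` says whether the orientation points
away from the crossing at the end `e`. -/
structure Orientation (T : Tangle) where
  out : T.Crossing × Fin 4 → Bool
  out_opposite : ∀ x i, out (x, i + 2) = !out (x, i)
  out_next : ∀ e f, T.next e = Sum.inl f → out f = !out e

end Tangle

/-- A block of rational tangles: a finite expression in sums and products of rational tangles
(see `Tangle.rational` for the data of a rational tangle). -/
inductive TangleBlock where
  | rational (s horizontal : Bool) (a₁ : ℕ+) (l : List (ℕ+ × Bool)) : TangleBlock
  | sum (A B : TangleBlock) : TangleBlock
  | prod (A B : TangleBlock) : TangleBlock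

namespace TangleBlock

/-- The tangle diagram of a block. -/
def toTangle : TangleBlock → Tangle
  | rational s horizontal a₁ l => Tangle.rational s horizontal a₁ l
  | sum A B => Tangle.sum A.toTangle B.toTangle
  | prod A B => Tangle.prod A.toTangle B.toTangle

/-- The block extends a crossing of sign `s`: the denominators of all its rational tangles have
the sign `s`. -/
def Extends (s : Bool) : TangleBlock → Prop
  | rational s' _ _ _ => s' = s
  | sum A B => A.Extends s ∧ B.Extends s
  | prod A B => A.Extends s ∧ B.Extends s

end TangleBlock

/-! ## Replacement of a crossing by a tangle -/

namespace OrientedDiagram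

variable (D : OrientedDiagram) (c : D.Crossing) (r : Fin 4) (T : Tangle)

/-- The sign (`true` for `1`) of the crossing `c` without orientation, in the position in which
its end `r` is drawn to the north-east. -/
def planeSign : Bool := D.isOver (c, r)

/-- The orientation of the tangle `T`, put in the place of `c` so that the end point `k` of `T`
comes to the end `k + r` of `c`, agrees with the orientation of the rest of the diagram. -/
def Fits (o : T.Orientation) : Prop := ∀ k, o.out (T.port k) = D.out (c, k + r)

open Classical in
/-- The end, in the diagram with `T` in the place of `c`, that corresponds to an end of `D`. -/
noncomputable def placeEnd (e : D.Crossing × Fin 4) : ({x // x ≠ c} ⊕ T.Crossing) × Fin 4 :=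
  if h : e.1 = c then (Sum.inr (T.port (e.2 - r)).1, (T.port (e.2 - r)).2)
  else (Sum.inl ⟨e.1, h⟩, e.2)

/-- The other end of an arc, in the diagram with `T` in the place of `c`. -/
noncomputable def replaceGlue :
    ({x // x ≠ c} ⊕ T.Crossing) × Fin 4 → ({x // x ≠ c} ⊕ T.Crossing) × Fin 4
  | (Sum.inl x, i) => D.placeEnd c r T (D.glue (x.1, i))
  | (Sum.inr y, i) => match T.next (y, i) with
    | Sum.inl e => (Sum.inr e.1, e.2)
    | Sum.inr k => D.placeEnd c r T (D.glue (c, k + r))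

/-- The regions of the new diagram arise from the regions of `D` and the corners of the crossings
of `T` by identifying corners on the same side of an arc inside `T`, and corners next to the end
points of `T` with the regions of `D` around `c`. -/
inductive RegionStep : D.Region ⊕ (T.Crossing × Fin 4) → D.Region ⊕ (T.Crossing × Fin 4) → Prop
  | inner (e f) (h : T.next e = Sum.inl f) : RegionStep (Sum.inr e) (Sum.inr (f.1, f.2 - 1))
  | left (k) : RegionStep (Sum.inr (T.port k)) (Sum.inl (D.region (c, k + r)))
  | right (k) : RegionStep (Sum.inr ((T.port k).1, (T.port k).2 - 1))
      (Sum.inl (D.region (c, k + r - 1)))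

/-- The region at a corner of the new diagram. -/
def replaceRegion : ({x // x ≠ c} ⊕ T.Crossing) × Fin 4 → Quot (D.RegionStep c r T)
  | (Sum.inl x, i) => Quot.mk _ (Sum.inl (D.region (x.1, i)))
  | (Sum.inr y, i) => Quot.mk _ (Sum.inr (y, i))

theorem replaceGlue_placeEnd (e : D.Crossing × Fin 4) :
    D.replaceGlue c r T (D.placeEnd c r T e) = D.placeEnd c r T (D.glue e) := by
  obtain ⟨x, i⟩ := e
  by_cases h : x = c
  · subst h
    have h1 : D.placeEnd x r T (x, i) = (Sum.inr (T.port (i - r)).1, (T.port (i - r)).2) := by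
      simp [placeEnd]
    rw [h1]
    simp only [replaceGlue, Prod.mk.eta, T.next_port, sub_add_cancel]
  · simp [placeEnd, replaceGlue, h]

/-- The oriented diagram obtained from `D` by replacing the crossing `c` by the oriented tangle
`T`, the end point `k` of `T` being put at the end `k + r` of `c`. -/
noncomputable def replace (o : T.Orientation) (ho : D.Fits c r T o) : OrientedDiagram where
  Crossing := {x // x ≠ c} ⊕ T.Crossing
  Loop := D.Loop
  Region := Quot (D.RegionStep c r T)
  finite_crossing := by
    have := D.finite_crossing
    have := T.finite_crossing
    infer_instance
  finite_loop := D.finite_loop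
  finite_region := by
    have := D.finite_region
    have := T.finite_crossing
    infer_instance
  glue := D.replaceGlue c r T
  glue_glue := by
    rintro ⟨x | y, i⟩
    · rw [replaceGlue, replaceGlue_placeEnd, D.glue_glue]
      simp [placeEnd, x.2]
    · rcases h : T.next (y, i) with e | k
      · simp [replaceGlue, h, T.next_symm _ _ h]
      · have h1 : D.replaceGlue c r T (Sum.inr y, i) = D.placeEnd c r T (D.glue (c, k + r)) := by
          simp [replaceGlue, h]
        rw [h1, replaceGlue_placeEnd, D.glue_glue]
        simp [placeEnd, T.port_of_next _ _ h]
  isOver e := Sum.elim (fun x => D.isOver (x.1, e.2)) (fun y => T.isOver (y, e.2)) e.1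
  isOver_succ x i := by
    rcases x with x | y
    · exact D.isOver_succ x.1 i
    · exact T.isOver_succ y i
  out e := Sum.elim (fun x => D.out (x.1, e.2)) (fun y => o.out (y, e.2)) e.1
  out_opposite x i := by
    rcases x with x | y
    · exact D.out_opposite x.1 i
    · exact o.out_opposite y i
  out_glue := by
    have key : ∀ e : D.Crossing × Fin 4,
        Sum.elim (fun x => D.out (x.1, (D.placeEnd c r T e).2))
          (fun y => o.out (y, (D.placeEnd c r T e).2)) (D.placeEnd c r T e).1 = D.out e := by
      rintro ⟨x, i⟩
      by_cases h : x = c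
      · subst h
        simp only [placeEnd, dite_true, Sum.elim_inr]
        rw [Prod.mk.eta, ho, sub_add_cancel]
      · simp [placeEnd, h]
    rintro ⟨x | y, i⟩
    · simp only [replaceGlue, key, D.out_glue, Sum.elim_inl]
    · rcases h : T.next (y, i) with e | k
      · simp only [replaceGlue, h, Sum.elim_inr]
        exact o.out_next _ _ h
      · simp only [replaceGlue, h, key, D.out_glue, Sum.elim_inr]
        rw [← T.port_of_next _ _ h, ho]
  region := D.replaceRegion c r T
  region_glue := by
    have key : ∀ e : D.Crossing × Fin 4,
        D.replaceRegion c r T ((D.placeEnd c r T e).1, (D.placeEnd c r T e).2 - 1) =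
          Quot.mk _ (Sum.inl (D.region (e.1, e.2 - 1))) := by
      rintro ⟨x, i⟩
      by_cases h : x = c
      · subst h
        simp only [placeEnd, dite_true, replaceRegion]
        have := Quot.sound (RegionStep.right (D := D) (c := x) (r := r) (T := T) (i - r))
        rwa [sub_add_cancel] at this
      · simp [placeEnd, h, replaceRegion]
    rintro ⟨x | y, i⟩
    · rw [replaceGlue, key, D.region_glue]
      rfl
    · rcases h : T.next (y, i) with e | k
      · simp only [replaceGlue, h, replaceRegion]
        exact (Quot.sound (RegionStep.inner _ _ h)).symm
      · simp only [replaceGlue, h]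
        rw [key, D.region_glue]
        change _ = Quot.mk _ (Sum.inr (y, i))
        rw [← T.port_of_next _ _ h]
        exact (Quot.sound (RegionStep.left k)).symm
  loopLeft l := Quot.mk _ (Sum.inl (D.loopLeft l))
  loopRight l := Quot.mk _ (Sum.inl (D.loopRight l))

/-- All crossings of the tangle that replaces `c` have, as oriented crossings, the sign of `c`. -/
def SameType (o : T.Orientation) (ho : D.Fits c r T o) : Prop :=
  ∀ y : T.Crossing, (D.replace c r T o ho).IsPositive (Sum.inr y) ↔ D.IsPositive c

end OrientedDiagram

/-! All crossings of the block have the plane sign of `c`, so the sign of one of them as an oriented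
crossing depends only on the direction of its smoothing. It is the sign of `c` if the crossing is
smoothed in the same direction as `c` (`Parallel`), and the opposite sign otherwise
(`isPositive_inr_iff`). It therefore suffices that the parallel crossings together act like the
single edge `c`, in the Seifert graph and in the checkerboard graph, and that the other crossings
can be separated from them. This is `Resembles`.

It is proved by induction on sums and products, which are both instances of `paste` up to a
rotation. Two parts smoothed in the same direction are combined in parallel or in series; if their
directions differ, one part hangs on a single Seifert circle of the other. Inside the block the
orientations at the four end points of a part may alternate, and then they do not select a
direction. The induction hypothesis `IsAdmissible` thus prescribes the direction only where the
strands flow in one, and otherwise asks for either. At `c` opposite ends are oppositely oriented, so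
the whole block does flow.

Homogeneity: all blocks of a graph have edges of one sign if and only if every coboundary modulo 2,
restricted to the edges of that sign and extended by zero, is again a coboundary
(`forall_isBlock_iff_isSeparator`). So homogeneity is a statement about functions constant along
Seifert circles (`isHomogeneous_iff`), and these can be cut and glued at the four ends of `c`
(`isHomogeneous_replace_iff`).

Alternativity: in the checkerboard graph as many edges leave a set of regions as enter it, so
directions do not matter: edges with a common end have the same sign (`isAlternative_iff`). Both end
regions of `c` are touched by parallel crossings of the block, which gives the passage from the new
diagram to the old one (`isAlternative_of_replace`). Conversely, `HasLabelling` maps the new regions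
to the old ones with the two ends of `c` identified; if all crossings of the block are parallel,
their edges are contracted to that vertex (`IsAlternative.replace`). -/

/-! ## Blocks and separators of a graph -/

namespace GraphBlock

variable {α β : Type} (G : Graph α β)

/-- A set `A` of edges is a separator of the graph formed by the edges in `S` if the restriction
to `A` of each coboundary (with coefficients modulo 2) is a coboundary. -/
def IsSeparator (S A : Set β) : Prop :=
  ∀ h : α → ZMod 2, ∃ h' : α → ZMod 2,
    (∀ e ∈ A, ∀ u v, G.IsLink e u v → h' u - h' v = h u - h v) ∧
      ∀ e ∈ S, e ∉ A → ∀ u v, G.IsLink e u v → h' u = h' v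

variable {G}

theorem IsSeparator.empty (S : Set β) : IsSeparator G S ∅ :=
  fun _ => ⟨0, by simp, by simp⟩

theorem IsSeparator.union {S A B : Set β} (hA : IsSeparator G S A) (hB : IsSeparator G S B)
    (hAS : A ⊆ S) :
    IsSeparator G S (A ∪ B) := by
  intro h
  obtain ⟨h₁, h₁A, h₁A'⟩ := hA h
  -- Once `h₁` accounts for the edges in `A`, the set `B` has to correct only the remainder, which
  -- may be nonzero on `B` alone.
  obtain ⟨h₂, h₂B, h₂B'⟩ := hB (h - h₁)
  refine ⟨h₁ + h₂, ?_, ?_⟩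
  · intro e he u v huv
    by_cases heB : e ∈ B
    · have := h₂B e heB u v huv
      simp only [Pi.sub_apply, Pi.add_apply] at this ⊢
      linear_combination this
    · have heA : e ∈ A := he.resolve_right heB
      have := h₁A e heA u v huv
      have := h₂B' e (hAS heA) heB u v huv
      simp only [Pi.add_apply]
      linear_combination this + ‹h₁ u - h₁ v = h u - h v›
  · intro e heS he u v huv
    simp only [Set.mem_union, not_or] at he
    simp [h₁A' e heS he.1 u v huv, h₂B' e heS he.2 u v huv]

theorem IsSeparator.compl {A : Set β} (hA : IsSeparator G Set.univ A) :
    IsSeparator G Set.univ Aᶜ := by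
  intro h
  obtain ⟨h₁, h₁A, h₁A'⟩ := hA h
  refine ⟨h - h₁, ?_, ?_⟩
  · intro e he u v huv
    have := h₁A' e trivial he u v huv
    simp only [Pi.sub_apply]
    linear_combination -this
  · intro e _ he u v huv
    have := h₁A e (not_not.1 he) u v huv
    simp only [Pi.sub_apply]
    linear_combination -this

theorem IsSeparator.inter {S A : Set β} (hA : IsSeparator G Set.univ A) :
    IsSeparator G S (A ∩ S) := by
  intro h
  obtain ⟨h₁, h₁A, h₁A'⟩ := hA h
  exact ⟨h₁, fun e he => h₁A e he.1, fun e heS he => h₁A' e trivial fun h => he ⟨h, heS⟩⟩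

theorem commonVertices_comm (A B : Set β) : commonVertices G A B = commonVertices G B A :=
  Set.ext fun _ => and_comm

/-- A part of a separator that has at most one vertex in common with the rest of it is itself
a separator. -/
theorem IsSeparator.of_subsingleton {R S A : Set β} (hS : IsSeparator G R S) (hAS : A ⊆ S)
    (hc : (commonVertices G A (S \ A)).Subsingleton) : IsSeparator G R A := by
  classical
  intro h
  -- Subtracting a constant makes `h` vanish at the common vertex. It can then be cut off to zero
  -- away from `A` without a jump on the edges of `S \ A`.
  obtain ⟨k, hk⟩ : ∃ k, ∀ v ∈ commonVertices G A (S \ A), h v = k := by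
    rcases hc.eq_empty_or_singleton with h0 | ⟨v, hv⟩
    · exact ⟨0, by simp [h0]⟩
    · exact ⟨h v, by simp [hv]⟩
  obtain ⟨h₁, h₁S, h₁S'⟩ := hS fun u => if ∃ e ∈ A, G.Inc e u then h u - k else 0
  have h0 : ∀ e ∈ S, e ∉ A → ∀ u, G.Inc e u →
      (if ∃ e ∈ A, G.Inc e u then h u - k else 0) = 0 := by
    intro e heS heA u heu
    split_ifs with hu
    · rw [hk u ⟨hu, e, ⟨heS, heA⟩, heu⟩, sub_self]
    · rfl
  refine ⟨h₁, ?_, ?_⟩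
  · intro e he u v huv
    rw [h₁S e (hAS he) u v huv, if_pos ⟨e, he, huv.inc_left⟩, if_pos ⟨e, he, huv.inc_right⟩]
    ring
  · intro e heR he u v huv
    by_cases heS : e ∈ S
    · have := h₁S e heS u v huv
      rw [h0 e heS he u huv.inc_left, h0 e heS he v huv.inc_right] at this
      linear_combination this
    · exact h₁S' e heR heS u v huv

/-- A function that is constant on each edge of a connected subgraph is constant on it. -/
theorem IsConnected.apply_eq {K : Set β} (hK : IsConnected G K) {h : α → ZMod 2}
    (hh : ∀ e ∈ K, ∀ u v, G.IsLink e u v → h u = h v) {e f : β} (he : e ∈ K) (hf : f ∈ K)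
    {u v : α} (hu : G.Inc e u) (hv : G.Inc f v) : h u = h v := by
  have hinc : ∀ e ∈ K, ∀ u v, G.Inc e u → G.Inc e v → h u = h v := by
    rintro e he u v ⟨w, hw⟩ ⟨z, hz⟩
    rcases hw.eq_and_eq_or_eq_and_eq hz with ⟨rfl, _⟩ | ⟨rfl, rfl⟩
    · rfl
    · exact hh e he _ _ hw
  by_contra hne
  -- Connectedness is applied to the edges on which the function has the constant value `h u`.
  obtain ⟨w, ⟨e', he', he'w⟩, f', hf', hf'w⟩ :=
    hK {e ∈ K | ∀ w, G.Inc e w → h w = h u} (Set.sep_subset _ _)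
    ⟨e, he, fun w hw => hinc e he _ _ hw hu⟩ ⟨f, hf, fun h' => hne (h'.2 v hv).symm⟩
  exact hf'.2 ⟨hf'.1, fun z hz => (hinc f' hf'.1 _ _ hz hf'w).trans (he'.2 w he'w)⟩

/-- A connected graph without cut vertex has no separator. -/
theorem IsConnected.not_isSeparator [Finite β] {B A : Set β} (hB : IsConnected G B)
    (hcut : ∀ v, ¬ IsCutVertex G B v) (hAB : A ⊆ B) (hA : A.Nonempty) (hA' : (B \ A).Nonempty) :
    ¬ IsSeparator G B A := by
  classical
  intro hsep
  -- A minimal separator `K` is connected, because a component of it would be a smaller one.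
  obtain ⟨K, hKA, ⟨hK0, hKsep⟩, hKmin⟩ := (Set.toFinite
    {K : Set β | K.Nonempty ∧ IsSeparator G B K}).exists_le_minimal
    (a := A) ⟨hA, hsep⟩
  have hKconn : IsConnected G K := by
    intro A₁ h₁ h₁0 h₁1
    by_contra hc
    rw [Set.not_nonempty_iff_eq_empty] at hc
    have := hKmin ⟨h₁0, hKsep.of_subsingleton h₁ (by simp [hc])⟩ h₁
    obtain ⟨x, hx⟩ := h₁1
    exact hx.2 (this hx.1)
  have hBK : (B \ K).Nonempty := hA'.mono fun x hx => ⟨hx.1, fun h => hx.2 (hKA h)⟩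
  -- `L` is a connected component of the complement of `K`; it can meet the rest of `B` only at
  -- vertices of `K`.
  obtain ⟨L, hLK, ⟨hL0, hLc⟩, hLmin⟩ := (Set.toFinite
    {L : Set β | L.Nonempty ∧ commonVertices G L ((B \ K) \ L) = ∅}).exists_le_minimal
    (a := B \ K) ⟨hBK, by simp [commonVertices]⟩
  have hLconn : IsConnected G L := by
    intro A₁ h₁ h₁0 h₁1
    by_contra hc
    rw [Set.not_nonempty_iff_eq_empty] at hc
    obtain ⟨x, hx⟩ := h₁1
    refine hx.2 (hLmin ⟨h₁0, ?_⟩ h₁ hx.1)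
    rw [Set.eq_empty_iff_forall_notMem] at hc hLc ⊢
    rintro v ⟨⟨e, he, hev⟩, f, hf, hfv⟩
    by_cases hfL : f ∈ L
    · exact hc v ⟨⟨e, he, hev⟩, f, ⟨hfL, hf.2⟩, hfv⟩
    · exact hLc v ⟨⟨e, h₁ he, hev⟩, f, ⟨hf.1, hfL⟩, hfv⟩
  have hLB : L ⊆ B := fun x hx => (hLK hx).1
  have hKL : ∀ x ∈ K, x ∉ L := fun x hx hx' => (hLK hx').2 hx
  have hBL : (B \ L).Nonempty := hK0.mono fun x hx => ⟨hAB (hKA hx), hKL x hx⟩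
  have htouch : ∀ v ∈ commonVertices G L (B \ L), ∃ e ∈ K, G.Inc e v := by
    rintro v ⟨⟨e, he, hev⟩, f, hf, hfv⟩
    by_contra hc
    refine Set.eq_empty_iff_forall_notMem.1 hLc v
      ⟨⟨e, he, hev⟩, f, ⟨⟨hf.1, fun h => ?_⟩, hf.2⟩, hfv⟩
    exact hc ⟨f, h, hfv⟩
  obtain ⟨v, hv⟩ := hB L hLB hL0 hBL
  -- A single point of contact would be a cut vertex.
  obtain ⟨u, hu, huv⟩ : ∃ u ∈ commonVertices G L (B \ L), u ≠ v := by
    by_contra! hc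
    exact hcut v ⟨L, hLB, hL0, hBL, Set.Subset.antisymm hc (by simpa using hv)⟩
  -- This function distinguishes `u` from `v`. But `h'` is constant on `L` and differs from it by a
  -- constant on `K`, and both `K` and `L` contain `u` and `v`.
  obtain ⟨h', h'K, h'K'⟩ := hKsep (Pi.single u 1)
  obtain ⟨e, he, heu⟩ := hu.1
  obtain ⟨f, hf, hfv⟩ := hv.1
  obtain ⟨e', he', heu'⟩ := htouch u hu
  obtain ⟨f', hf', hfv'⟩ := htouch v hv
  have h1 : h' u = h' v := hLconn.apply_eq (fun e he => h'K' e (hLB he) (hLK he).2) he hf heu hfv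
  have h2 : (h' - Pi.single u 1 : α → ZMod 2) u = (h' - Pi.single u 1 : α → ZMod 2) v :=
    hKconn.apply_eq (fun e he a b hab => by
      have := h'K e he a b hab
      simp only [Pi.sub_apply]
      linear_combination this) he' hf' heu' hfv'
  simp [h1, huv.symm] at h2

/-- Separators are the unions of blocks: a minimal separator containing a given edge has no cut
vertex and so lies in one block, and a block that contained edges of both kinds would itself be
separated. -/
theorem forall_isBlock_iff_isSeparator [Finite β] (hG : G.edgeSet = Set.univ) (P : β → Prop) :
    (∀ B, IsBlock G B → ∀ x ∈ B, ∀ y ∈ B, (P x ↔ P y)) ↔ IsSeparator G Set.univ {x | P x} := by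
  constructor
  · intro hP
    obtain ⟨S, -, ⟨hSP, hS⟩, hmax⟩ := (Set.toFinite
    {S : Set β | S ⊆ {x | P x} ∧ IsSeparator G Set.univ S}).exists_le_maximal
      (a := ∅) ⟨Set.empty_subset _, .empty _⟩
    suffices {x | P x} ⊆ S by rwa [← Set.Subset.antisymm hSP this]
    intro x hx
    have hfull : IsSeparator G Set.univ (Set.univ : Set β) := fun h => ⟨h, by simp⟩
    obtain ⟨K, -, ⟨hxK, hK⟩, hmin⟩ := (Set.toFinite
    {K : Set β | x ∈ K ∧ IsSeparator G Set.univ K}).exists_le_minimal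
      (a := Set.univ) ⟨trivial, hfull⟩
    -- If `K` fell apart at no vertex or at one, both pieces would be separators, and the one
    -- containing `x` would contradict minimality.
    have key : ∀ A ⊆ K, A.Nonempty → (K \ A).Nonempty →
        ¬ (commonVertices G A (K \ A)).Subsingleton := by
      rintro A hA ⟨y, hy⟩ ⟨z, hz⟩ hc
      by_cases hxA : x ∈ A
      · exact hz.2 (hmin ⟨hxA, hK.of_subsingleton hA hc⟩ hA hz.1)
      · refine (hmin (y := K \ A) ⟨⟨hxK, hxA⟩, hK.of_subsingleton Set.sdiff_subset ?_⟩
          Set.sdiff_subset (hA hy)).2 hy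
        rwa [commonVertices_comm, Set.sdiff_sdiff_cancel_left hA]
    have hKconn : IsConnected G K := by
      intro A hA h0 h1
      by_contra hc
      exact key A hA h0 h1 (by simp [Set.not_nonempty_iff_eq_empty.1 hc])
    have hKcut : ∀ v, ¬ IsCutVertex G K v := by
      rintro v ⟨A, hA, h0, h1, h⟩
      exact key A hA h0 h1 (by simp [h])
    obtain ⟨B, hKB, hB⟩ := (Set.toFinite
    {B : Set β | B ⊆ G.edgeSet ∧ B.Nonempty ∧ IsConnected G B ∧
      ∀ v, ¬ IsCutVertex G B v}).exists_le_maximal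
      (a := K) ⟨by simp [hG], ⟨x, hxK⟩, hKconn, hKcut⟩
    refine hmax (y := S ∪ K) ⟨Set.union_subset hSP fun y hy => ?_, hS.union hK
      (Set.subset_univ _)⟩ Set.subset_union_left (Or.inr hxK)
    exact (hP B hB x (hKB hxK) y (hKB hy)).1 hx
  · intro hP B hB
    have key : ∀ x ∈ B, ∀ y ∈ B, P x → P y := by
      intro x hx y hy hPx
      by_contra hPy
      exact hB.prop.2.2.1.not_isSeparator hB.prop.2.2.2 Set.inter_subset_right ⟨x, hPx, hx⟩
        ⟨y, hy, fun h => hPy h.1⟩ hP.inter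
    exact fun x hx y hy => ⟨key x hx y hy, key y hy x hx⟩

end GraphBlock

/-! ## Seifert circles and regions -/

/-- Statements about the four ends can thus be checked starting from any end `t`, which makes
arguments invariant under rotation. -/
theorem Fin.forall_fin_four_add (t : Fin 4) {P : Fin 4 → Prop} :
    (∀ k, P k) ↔ P t ∧ P (t + 1) ∧ P (t + 2) ∧ P (t + 3) := by
  refine ⟨fun h => ⟨h _, h _, h _, h _⟩, fun ⟨h0, h1, h2, h3⟩ k => ?_⟩
  have : ∀ t k : Fin 4, k = t ∨ k = t + 1 ∨ k = t + 2 ∨ k = t + 3 := by decide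
  rcases this t k with rfl | rfl | rfl | rfl <;> assumption

namespace OrientedDiagram

variable {D : OrientedDiagram}

/-- A function on the ends of `D` that is constant along the Seifert circles. -/
def IsSeifertInvariant (D : OrientedDiagram) (h : D.Crossing × Fin 4 → ZMod 2) : Prop :=
  (∀ e, h (D.glue e) = h e) ∧ ∀ x i, D.out (x, i) ≠ D.out (x, i + 1) → h (x, i) = h (x, i + 1)

theorem out_add_two (x : D.Crossing) (i : Fin 4) : D.out (x, i + 2) = !D.out (x, i) :=
  D.out_opposite x i

theorem out_add_three (x : D.Crossing) (i : Fin 4) : D.out (x, i + 3) = !D.out (x, i + 1) := by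
  rw [← D.out_opposite, add_assoc]; rfl

/-- The corner between the outgoing ends, when the smoothing joins the ends `i` and `i + 1`. -/
theorem outCorner_of_out_ne {x : D.Crossing} {i : Fin 4} (h : D.out (x, i) ≠ D.out (x, i + 1)) :
    D.outCorner x = if D.out (x, i) then i + 3 else i + 1 := by
  have h2 := D.out_opposite x 0
  have h3 := D.out_opposite x 1
  simp only [zero_add, Fin.reduceAdd] at h2 h3
  unfold outCorner
  revert h
  fin_cases i <;> simp [h2, h3] <;> generalize D.out (x, 0) = a <;>
    generalize D.out (x, 1) = b <;> revert a b <;> decide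

theorem outCorner_eq_or {x : D.Crossing} {i : Fin 4} (h : D.out (x, i) ≠ D.out (x, i + 1)) :
    D.outCorner x = i + 1 ∨ D.outCorner x = i + 3 := by
  rw [outCorner_of_out_ne h]
  split_ifs <;> simp

/-- The corner between the outgoing ends is `i + 1` or `i + 3`, and these two ends are on the same
strand. So the sign needs only the direction of the smoothing. -/
theorem isPositive_iff {x : D.Crossing} {i : Fin 4} (h : D.out (x, i) ≠ D.out (x, i + 1)) :
    D.IsPositive x ↔ D.isOver (x, i + 1) = true := by
  unfold IsPositive
  have : D.isOver (x, i + 3) = D.isOver (x, i + 1) := by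
    have h1 := D.isOver_succ x (i + 1)
    have h2 := D.isOver_succ x (i + 1 + 1)
    rw [h1, Bool.not_not] at h2
    rw [← h2, add_assoc, add_assoc]
    rfl
  rcases outCorner_eq_or h with h | h <;> rw [h]
  rw [this]

/-- The edge of the enhanced checkerboard graph given by `x` has the end `R`. -/
def Touches (D : OrientedDiagram) (x : D.Crossing) (R : D.Region) : Prop :=
  D.edgeHead x = R ∨ D.edgeTail x = R

theorem touches_iff {x : D.Crossing} {i : Fin 4} (h : D.out (x, i) ≠ D.out (x, i + 1))
    {R : D.Region} : D.Touches x R ↔ D.region (x, i + 1) = R ∨ D.region (x, i + 3) = R := by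
  unfold Touches edgeHead edgeTail
  rcases outCorner_eq_or h with h | h <;> rw [h, add_assoc]
  · rfl
  · rw [or_comm]; rfl

theorem out_ne_or (x : D.Crossing) (i : Fin 4) :
    D.out (x, i) ≠ D.out (x, i + 1) ∨ D.out (x, i + 1) ≠ D.out (x, i + 1 + 1) := by
  have := D.out_opposite x i
  rw [add_assoc, show (1 + 1 : Fin 4) = 2 from rfl]
  cases h0 : D.out (x, i) <;> cases h1 : D.out (x, i + 1) <;> simp_all

/-! ### Coboundaries on the Seifert graph, read off at the ends of a crossing -/

namespace IsSeifertInvariant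

variable {h : D.Crossing × Fin 4 → ZMod 2}

/-- The smoothing pairs the four ends into two neighbouring pairs, and opposite ends lie in
different pairs. Modulo 2 the order of the difference is irrelevant. -/
theorem sub_succ (hh : D.IsSeifertInvariant h) (x : D.Crossing) (i : Fin 4) :
    h (x, i + 1) - h (x, i + 3) = h (x, i) - h (x, i + 2) := by
  have h2 := D.out_opposite x i
  have h3 := D.out_opposite x (i + 1)
  have k0 := hh.2 x i
  have k1 := hh.2 x (i + 1)
  have k2 := hh.2 x (i + 2)
  have k3 := hh.2 x (i + 3)
  simp only [add_assoc, Fin.reduceAdd, add_zero] at h2 h3 k0 k1 k2 k3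
  rw [h2] at k1 k2
  rw [h3] at k2 k3
  have hneg : ∀ a b : ZMod 2, a - b = b - a := by decide
  rcases hd : D.out (x, i) <;> rcases hd' : D.out (x, i + 1) <;> simp [hd, hd'] at k0 k1 k2 k3
  · rw [k1, k3, hneg]
  · rw [k0, k2]
  · rw [k0, k2]
  · rw [k1, k3, hneg]

theorem sub_add_two (hh : D.IsSeifertInvariant h) (x : D.Crossing) (i : Fin 4) :
    h (x, i) - h (x, i + 2) = h (x, 0) - h (x, 2) := by
  have h0 := hh.sub_succ x 0
  have h1 := hh.sub_succ x 1
  have h2 := hh.sub_succ x 2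
  simp only [zero_add, Fin.reduceAdd] at h0 h1 h2
  fin_cases i
  · rfl
  · exact h0
  · exact h1.trans h0
  · exact h2.trans (h1.trans h0)

theorem sub_outCorner (hh : D.IsSeifertInvariant h) (x : D.Crossing) :
    h (x, D.outCorner x) - h (x, D.outCorner x + 1) = h (x, 0) - h (x, 2) := by
  obtain ⟨i, hi⟩ : ∃ i, D.out (x, i) ≠ D.out (x, i + 1) := (out_ne_or x 0).elim (⟨_, ·⟩) (⟨_, ·⟩)
  have hi' : D.out (x, i + 2) ≠ D.out (x, i + 2 + 1) := by
    rw [add_assoc, show (2 + 1 : Fin 4) = 3 from rfl, out_add_two, out_add_three]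
    simpa using hi
  have h0 := hh.2 x i hi
  have h1 := hh.2 x _ hi'
  have h2 := hh.sub_add_two x i
  have hneg : ∀ a b : ZMod 2, a - b = b - a := by decide
  rw [← h2]
  rcases outCorner_eq_or hi with h | h <;> rw [h, add_assoc]
  · rw [← h0]; rfl
  · rw [h1, hneg, add_assoc]
    simp only [Fin.reduceAdd, add_zero]

end IsSeifertInvariant

/-- Functions on the vertices of the Seifert graph are invariant functions on ends, and the
coboundary at `x` is the difference between two opposite ends. -/
theorem seifertGraph_isSeparator_iff (P : Set D.Crossing) :
    GraphBlock.IsSeparator D.seifertGraph Set.univ P ↔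
      ∀ h, D.IsSeifertInvariant h → ∃ h', D.IsSeifertInvariant h' ∧
        (∀ x ∈ P, h' (x, 0) - h' (x, 2) = h (x, 0) - h (x, 2)) ∧
        ∀ x ∉ P, h' (x, 0) - h' (x, 2) = 0 := by
  have hinv : ∀ f : D.SeifertCircle → ZMod 2,
      D.IsSeifertInvariant fun e => f (D.seifertCircle e) := fun f =>
    ⟨fun e => congr_arg (fun c => f (Sum.inl c)) (Quot.sound (.inl rfl)).symm,
      fun x i hi => congr_arg (fun c => f (Sum.inl c)) (Quot.sound (.inr ⟨rfl, hi⟩))⟩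
  have hlink : ∀ f : D.SeifertCircle → ZMod 2, ∀ x u v, D.seifertGraph.IsLink x u v →
      f u - f v = f (D.seifertCircle (x, 0)) - f (D.seifertCircle (x, 2)) := by
    intro f x u v huv
    rw [← (hinv f).sub_outCorner x]
    rcases Sym2.eq_iff.1 (show D.seifertEnds x = s(u, v) from huv) with ⟨rfl, rfl⟩ | ⟨rfl, rfl⟩
    · rfl
    · exact (by decide : ∀ a b : ZMod 2, a - b = b - a) _ _
  constructor
  · intro hP h hh
    -- Components without crossings are isolated vertices, so their value can be set to 0.
    let f : D.SeifertCircle → ZMod 2 := Sum.elim (Quot.lift h fun e e' he => by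
      rcases he with rfl | ⟨he, he'⟩
      · exact (hh.1 e).symm
      · rw [he] at he' ⊢
        exact hh.2 e.1 e.2 he') 0
    obtain ⟨f', h1, h2⟩ := hP f
    refine ⟨fun e => f' (D.seifertCircle e), hinv f', fun x hx => ?_, fun x hx => ?_⟩
    · rw [← hlink f' x _ _ rfl, h1 x hx _ _ rfl, hlink f x _ _ rfl]
      rfl
    · rw [← hlink f' x _ _ rfl, h2 x trivial hx _ _ rfl, sub_self]
  · intro hP f
    obtain ⟨h', hh', h1, h2⟩ := hP _ (hinv f)
    let f' : D.SeifertCircle → ZMod 2 := Sum.elim (Quot.lift h' fun e e' he => by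
      rcases he with rfl | ⟨he, he'⟩
      · exact (hh'.1 e).symm
      · rw [he] at he' ⊢
        exact hh'.2 e.1 e.2 he') 0
    refine ⟨f', fun x hx u v huv => ?_, fun x _ hx u v huv => ?_⟩
    · rw [hlink f x u v huv, hlink f' x u v huv]
      exact h1 x hx
    · rw [← sub_eq_zero, hlink f' x u v huv]
      exact h2 x hx

/-- Homogeneity in terms of the crossings of one sign. -/
theorem isHomogeneous_iff (p : Prop) :
    D.IsHomogeneous ↔
      ∀ h, D.IsSeifertInvariant h → ∃ h', D.IsSeifertInvariant h' ∧
        (∀ x, (D.IsPositive x ↔ p) → h' (x, 0) - h' (x, 2) = h (x, 0) - h (x, 2)) ∧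
        ∀ x, ¬ (D.IsPositive x ↔ p) → h' (x, 0) - h' (x, 2) = 0 := by
  have := D.finite_crossing
  refine (GraphBlock.forall_isBlock_iff_isSeparator (G := D.seifertGraph) rfl _).trans
    (Iff.trans ?_ (seifertGraph_isSeparator_iff {x | D.IsPositive x ↔ p}))
  by_cases hp : p
  · simp [hp]
  · have : {x | D.IsPositive x ↔ p} = {x | D.IsPositive x}ᶜ := by ext; simp [hp]
    rw [this]
    exact ⟨.compl, fun h => by simpa using h.compl⟩

/-! ### The enhanced checkerboard graph is balanced -/

/-- The next corner of the region at a corner. -/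
def nextCorner (D : OrientedDiagram) (e : D.Crossing × Fin 4) : D.Crossing × Fin 4 :=
  ((D.glue e).1, (D.glue e).2 - 1)

theorem nextCorner_bijective : Function.Bijective D.nextCorner := by
  have hg : Function.Bijective D.glue := Function.Involutive.bijective D.glue_glue
  exact ((Equiv.refl D.Crossing).prodCongr (Equiv.subRight (1 : Fin 4))).bijective.comp hg

/-- In each set of regions, as many edges of the enhanced checkerboard graph start as end. -/
theorem card_edgeTail_mem (S : Set D.Region) :
    Nat.card {x // D.edgeTail x ∈ S} = Nat.card {x // D.edgeHead x ∈ S} := by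
  classical
  have := D.finite_crossing
  have : Fintype D.Crossing := Fintype.ofFinite _
  let b : Bool → ℤ := fun b => if b then 1 else 0
  let w : D.Crossing × Fin 4 → ℤ := fun e => if D.region e ∈ S then 1 else 0
  -- The bracket is 1 at the corner between outgoing ends, -1 at the one between incoming ends, and
  -- 0 at the other two. The sum vanishes because each arc points away from exactly one of its two
  -- ends.
  have hsum : ∑ e, w e * (b (D.out (e.1, e.2 + 1)) + b (D.out e) - 1) = 0 := by
    have h1 : ∑ e, w e * b (D.out (e.1, e.2 + 1)) = ∑ e, w e * (1 - b (D.out e)) := by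
      rw [← (nextCorner_bijective (D := D)).sum_comp]
      refine Finset.sum_congr rfl fun e _ => ?_
      have hw : w (D.nextCorner e) = w e := by
        simp only [w, nextCorner, D.region_glue]
      rw [hw]
      simp only [nextCorner, sub_add_cancel, Prod.mk.eta, D.out_glue]
      cases D.out e <;> simp [b]
    simp only [mul_sub, mul_add, Finset.sum_sub_distrib, Finset.sum_add_distrib] at h1 ⊢
    rw [h1]; ring
  have hx : ∀ x : D.Crossing, ∑ i, w (x, i) * (b (D.out (x, i + 1)) + b (D.out (x, i)) - 1) =
      (if D.edgeHead x ∈ S then 1 else 0) - if D.edgeTail x ∈ S then 1 else 0 := by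
    intro x
    have h2 := D.out_opposite x 0
    have h3 := D.out_opposite x 1
    simp only [zero_add, Fin.reduceAdd] at h2 h3
    simp only [Fin.sum_univ_four, zero_add, Fin.reduceAdd, h2, h3]
    unfold edgeHead edgeTail outCorner
    cases h0 : D.out (x, 0) <;> cases h1 : D.out (x, 1) <;> simp [b, w] <;> ring
  rw [Fintype.sum_prod_type, Finset.sum_congr rfl fun x _ => hx x, Finset.sum_sub_distrib,
    sub_eq_zero] at hsum
  simp only [Finset.sum_boole, Nat.cast_inj] at hsum
  rw [Nat.card_eq_fintype_card, Nat.card_eq_fintype_card, Fintype.card_subtype,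
    Fintype.card_subtype]
  exact hsum.symm

/-- Let `S` be the set of terminal vertices of the edges of one sign. Edges that start in `S` have
this sign and so end in `S`; by balance there are no other edges that end in `S`. Hence every edge
that touches `S` has this sign. -/
theorem IsAlternative.isPositive_iff_of_touches (hD : D.IsAlternative) {x y : D.Crossing}
    {R : D.Region} (hx : D.Touches x R) (hy : D.Touches y R) :
    D.IsPositive x ↔ D.IsPositive y := by
  have := D.finite_crossing
  have hpair : ∀ x y, D.edgeHead x = D.edgeTail y → (D.IsPositive x ↔ D.IsPositive y) :=
    fun x y h => hD [x, y] (by simpa [IsWalk] using h) x (by simp) y (by simp)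
  -- the terminal vertices of the edges of one sign
  have key : ∀ p : Prop, ∀ z, D.edgeTail z ∈ {R | ∃ y, (D.IsPositive y ↔ p) ∧ D.edgeHead y = R} ↔
      D.edgeHead z ∈ {R | ∃ y, (D.IsPositive y ↔ p) ∧ D.edgeHead y = R} := by
    intro p
    have h1 : {z | D.edgeTail z ∈ {R | ∃ y, (D.IsPositive y ↔ p) ∧ D.edgeHead y = R}} ⊆
        {z | D.edgeHead z ∈ {R | ∃ y, (D.IsPositive y ↔ p) ∧ D.edgeHead y = R}} := by
      rintro z ⟨y, hy, hyz⟩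
      exact ⟨z, by rw [← hpair y z hyz, hy], rfl⟩
    have h2 := Set.eq_of_subset_of_ncard_le h1 (card_edgeTail_mem _).ge
    exact fun z => Set.ext_iff.1 h2 z
  have hsign : ∀ p : Prop, ∀ z, D.edgeHead z ∈ {R | ∃ y, (D.IsPositive y ↔ p) ∧ D.edgeHead y = R} →
      (D.IsPositive z ↔ p) := by
    rintro p z hz
    obtain ⟨y, hy, hyz⟩ := (key p z).2 hz
    rw [← hpair y z hyz, hy]
  have hmem : ∀ z, D.Touches z R → ∃ y, (D.IsPositive y ↔ D.IsPositive z) ∧ D.edgeHead y = R := by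
    rintro z (rfl | rfl)
    · exact ⟨z, Iff.rfl, rfl⟩
    · exact (key _ z).2 ⟨z, Iff.rfl, rfl⟩
  obtain ⟨x', hx', hx'R⟩ := hmem x hx
  have := hsign (D.IsPositive y) x' (by rw [hx'R]; exact hmem y hy)
  rw [← hx', this]

theorem isAlternative_iff :
    D.IsAlternative ↔
      ∀ x y R, D.Touches x R → D.Touches y R → (D.IsPositive x ↔ D.IsPositive y) := by
  refine ⟨fun h x y R hx hy => h.isPositive_iff_of_touches hx hy, fun h w hw => ?_⟩
  suffices ∀ (w : List D.Crossing) (x : D.Crossing), D.IsWalk (x :: w) →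
      ∀ y ∈ w, (D.IsPositive x ↔ D.IsPositive y) by
    cases w with
    | nil => simp
    | cons z w =>
      have key : ∀ x ∈ z :: w, (D.IsPositive z ↔ D.IsPositive x) := by
        intro x hx
        rcases List.mem_cons.1 hx with rfl | hx
        · rfl
        · exact this w z hw x hx
      exact fun x hx y hy => (key x hx).symm.trans (key y hy)
  intro w
  induction w with
  | nil => simp
  | cons z w ih =>
    intro x hx y hy
    have h1 : D.edgeHead x = D.edgeTail z ∧ D.IsWalk (z :: w) := List.isChain_cons_cons.1 hx
    have h2 : D.IsPositive x ↔ D.IsPositive z := h x z _ (.inl h1.1) (.inr rfl)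
    rcases List.mem_cons.1 hy with rfl | hy
    · exact h2
    · exact h2.trans (ih z h1.2 y hy)

end OrientedDiagram

/-! ## Tangles built from single crossings by sums and products -/

namespace TangleBlock

/-- A block that extends a crossing of sign `s` is built from single crossings of sign `s` by sums
and products. -/
theorem toTangle_induction {s : Bool} {P : Tangle → Prop} (single : P (.single s))
    (sum : ∀ A B, P A → P B → P (.sum A B)) (prod : ∀ A B, P A → P B → P (.prod A B)) :
    ∀ b : TangleBlock, b.Extends s → P b.toTangle := by
  have join : ∀ h A B, P A → P B → P (.join h A B) := by
    rintro (_ | _) A B hA hB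
    · exact prod A B hA hB
    · exact sum A B hA hB
  have twist : ∀ h n, P (.twist h s n) := by
    intro h n
    induction n with
    | zero => exact single
    | succ n ih => exact join h _ _ ih single
  have boxes : ∀ l h T, P T → P (Tangle.addBoxes s h T l) := by
    intro l
    induction l with
    | nil => exact fun h T hT => hT
    | cons x l ih =>
      obtain ⟨a, _ | _⟩ := x
      · exact fun h T hT => ih _ _ (join h _ _ (twist h _) hT)
      · exact fun h T hT => ih _ _ (join h _ _ hT (twist h _))
  intro b
  induction b with
  | rational s' h a l => rintro rfl; exact boxes _ _ _ (twist _ _)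
  | sum A B hA hB => exact fun h => sum _ _ (hA h.1) (hB h.2)
  | prod A B hA hB => exact fun h => prod _ _ (hA h.1) (hB h.2)

end TangleBlock

namespace Tangle

/-- The sum of two tangles, turned so that the end points `t` and `t + 3` of the first are joined
to the end points `t + 1` and `t + 2` of the second. -/
structure IsJoin (t : Fin 4) (f g : Fin 4 → Option (Fin 4)) : Prop where
  zero : f t = some (t + 1)
  one : f (t + 1) = none
  two : f (t + 2) = none
  three : f (t + 3) = some (t + 2)
  zero' : g t = none
  one' : g (t + 1) = some t
  two' : g (t + 2) = some (t + 3)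
  three' : g (t + 3) = none

/-! ### Ends and arcs of a pasted tangle -/

section Paste

variable {A B : Tangle} {f g : Fin 4 → Option (Fin 4)}
  {hfg : ∀ k l, f k = some l ↔ g l = some k} {hn : ∀ k, f k = none ↔ g k ≠ none}

/-- The ends of the first tangle in the pasted tangle. -/
def inlEnd (A B : Tangle) (e : A.Crossing × Fin 4) : (A.Crossing ⊕ B.Crossing) × Fin 4 :=
  (Sum.inl e.1, e.2)

/-- The ends of the second tangle in the pasted tangle. -/
def inrEnd (A B : Tangle) (e : B.Crossing × Fin 4) : (A.Crossing ⊕ B.Crossing) × Fin 4 :=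
  (Sum.inr e.1, e.2)

theorem next_inlEnd {e e' : A.Crossing × Fin 4} (h : A.next e = .inl e') :
    (paste A B f g hfg hn).next (inlEnd A B e) = .inl (inlEnd A B e') := by
  simp [paste, inlEnd, h]

theorem next_inrEnd {e e' : B.Crossing × Fin 4} (h : B.next e = .inl e') :
    (paste A B f g hfg hn).next (inrEnd A B e) = .inl (inrEnd A B e') := by
  simp [paste, inrEnd, h]

theorem next_inlEnd_port {k l : Fin 4} (h : f k = some l) :
    (paste A B f g hfg hn).next (inlEnd A B (A.port k)) = .inl (inrEnd A B (B.port l)) := by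
  simp [paste, inlEnd, inrEnd, A.next_port, h]

theorem next_inrEnd_port {k l : Fin 4} (h : f k = some l) :
    (paste A B f g hfg hn).next (inrEnd A B (B.port l)) = .inl (inlEnd A B (A.port k)) :=
  (paste A B f g hfg hn).next_symm _ _ (next_inlEnd_port h)

/-- An inner arc of the pasted tangle is an inner arc of one part or crosses the seam in one of the
two directions. -/
theorem forall_next_paste
    {P : (A.Crossing ⊕ B.Crossing) × Fin 4 → (A.Crossing ⊕ B.Crossing) × Fin 4 → Prop}
    (hA : ∀ e e', A.next e = .inl e' → P (inlEnd A B e) (inlEnd A B e'))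
    (hB : ∀ e e', B.next e = .inl e' → P (inrEnd A B e) (inrEnd A B e'))
    (hAB : ∀ k l, f k = some l → P (inlEnd A B (A.port k)) (inrEnd A B (B.port l)))
    (hBA : ∀ k l, f k = some l → P (inrEnd A B (B.port l)) (inlEnd A B (A.port k))) :
    ∀ e e', (paste A B f g hfg hn).next e = .inl e' → P e e' := by
  rintro ⟨x | x, i⟩ e' h
  · rcases hx : A.next (x, i) with d | k
    · have := next_inlEnd (B := B) (hfg := hfg) (hn := hn) hx
      cases (this.symm.trans h)
      exact hA _ _ hx
    · have hp := A.port_of_next _ _ hx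
      rcases hk : f k with _ | l
      · simp [paste, hx, hk] at h
      · have := next_inlEnd_port (A := A) (B := B) (hfg := hfg) (hn := hn) hk
        rw [hp] at this
        cases (this.symm.trans h)
        have := hAB k l hk
        rwa [hp] at this
  · rcases hx : B.next (x, i) with d | l
    · have := next_inrEnd (A := A) (hfg := hfg) (hn := hn) hx
      cases (this.symm.trans h)
      exact hB _ _ hx
    · have hp := B.port_of_next _ _ hx
      rcases hl : g l with _ | k
      · simp [paste, hx, hl] at h
      · have hk := (hfg k l).2 hl
        have := next_inrEnd_port (A := A) (B := B) (hfg := hfg) (hn := hn) hk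
        rw [hp] at this
        cases (this.symm.trans h)
        have := hBA k l hk
        rwa [hp] at this

theorem port_of_eq_none {k : Fin 4} (h : f k = none) :
    (paste A B f g hfg hn).port k = inlEnd A B (A.port k) := by
  simp [paste, h, inlEnd]

theorem port_of_eq_some {k l : Fin 4} (h : f k = some l) :
    (paste A B f g hfg hn).port k = inrEnd A B (B.port k) := by
  simp [paste, h, inrEnd]

variable (f g hfg hn) in
/-- The function on the ends of a pasted tangle given by functions on the ends of its parts. -/
def pasteFun {X : Type} (F : A.Crossing × Fin 4 → X) (G : B.Crossing × Fin 4 → X) :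
    (paste A B f g hfg hn).Crossing × Fin 4 → X :=
  fun e => Sum.elim (fun x => F (x, e.2)) (fun x => G (x, e.2)) e.1

/-- The orientation of the first part of an oriented tangle. -/
def Orientation.left (o : (paste A B f g hfg hn).Orientation) : A.Orientation where
  out e := o.out (inlEnd A B e)
  out_opposite x i := o.out_opposite (Sum.inl x) i
  out_next _ _ h := o.out_next _ _ (next_inlEnd h)

/-- The orientation of the second part of an oriented tangle. -/
def Orientation.right (o : (paste A B f g hfg hn).Orientation) : B.Orientation where
  out e := o.out (inrEnd A B e)
  out_opposite x i := o.out_opposite (Sum.inr x) i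
  out_next _ _ h := o.out_next _ _ (next_inrEnd h)

end Paste

/-! ### Regions -/

/-- A function on the corners of a tangle that is constant on the regions. -/
def IsRegionInvariant (T : Tangle) {X : Type} (F : T.Crossing × Fin 4 → X) : Prop :=
  ∀ e e', T.next e = .inl e' → F e = F (e'.1, e'.2 - 1)

/-- The regions at the four sides of the tangle are not divided by its crossings: the corners next
to consecutive end points are in the same region. -/
def HasSides (T : Tangle) : Prop :=
  ∀ (X : Type) (F : T.Crossing × Fin 4 → X), T.IsRegionInvariant F →
    ∀ k, F ((T.port (k + 1)).1, (T.port (k + 1)).2 - 1) = F (T.port k)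

/-- There is a function on the regions which has given values on the four sides, equal ones for the
sides `t + 1` and `t + 3`, and which takes this value at the corners `t + 1` and `t + 3` of all
crossings. -/
def HasLabelling (T : Tangle) (t : Fin 4) : Prop :=
  ∀ (X : Type) (n s w : X), ∃ F : T.Crossing × Fin 4 → X, T.IsRegionInvariant F ∧
    F (T.port t) = n ∧ F (T.port (t + 1)) = w ∧ F (T.port (t + 2)) = s ∧ F (T.port (t + 3)) = w ∧
    ∀ x, F (x, t + 1) = w ∧ F (x, t + 3) = w

section Paste

variable {A B : Tangle} {f g : Fin 4 → Option (Fin 4)}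
  {hfg : ∀ k l, f k = some l ↔ g l = some k} {hn : ∀ k, f k = none ↔ g k ≠ none} {t : Fin 4}

theorem isRegionInvariant_paste {X : Type} {F : (paste A B f g hfg hn).Crossing × Fin 4 → X} :
    (paste A B f g hfg hn).IsRegionInvariant F ↔
      A.IsRegionInvariant (fun e => F (inlEnd A B e)) ∧
      B.IsRegionInvariant (fun e => F (inrEnd A B e)) ∧
      ∀ k l, f k = some l →
        F (inlEnd A B (A.port k)) = F (inrEnd A B ((B.port l).1, (B.port l).2 - 1)) ∧
        F (inrEnd A B (B.port l)) = F (inlEnd A B ((A.port k).1, (A.port k).2 - 1)) := by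
  constructor
  · exact fun h => ⟨fun e e' he => h _ _ (next_inlEnd he), fun e e' he => h _ _ (next_inrEnd he),
      fun k l hk => ⟨h _ _ (next_inlEnd_port hk), h _ _ (next_inrEnd_port hk)⟩⟩
  · exact fun ⟨h1, h2, h3⟩ => forall_next_paste h1 h2 (fun k l hk => (h3 k l hk).1)
      (fun k l hk => (h3 k l hk).2)

theorem IsJoin.eq_some (h : IsJoin t f g) {P : Fin 4 → Fin 4 → Prop} :
    (∀ k l, f k = some l → P k l) ↔ P t (t + 1) ∧ P (t + 3) (t + 2) := by
  constructor
  · exact fun H => ⟨H _ _ h.zero, H _ _ h.three⟩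
  · intro H k
    revert k
    rw [Fin.forall_fin_four_add t, h.zero, h.one, h.two, h.three]
    simpa using H

/-- The sides `t` and `t + 2` run along both parts and pass the seam; the other two sides each
belong to one part. -/
theorem HasSides.paste (hA : A.HasSides) (hB : B.HasSides) (hf : IsJoin t f g) :
    (paste A B f g hfg hn).HasSides := by
  intro X F hF
  obtain ⟨h1, h2, h3⟩ := isRegionInvariant_paste.1 hF
  rw [hf.eq_some] at h3
  have a := (Fin.forall_fin_four_add t).1 (hA X _ h1)
  have b := (Fin.forall_fin_four_add t).1 (hB X _ h2)
  rw [Fin.forall_fin_four_add t]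
  simp only [add_assoc, Fin.reduceAdd, add_zero] at a b ⊢
  rw [port_of_eq_some hf.zero, port_of_eq_none hf.one, port_of_eq_none hf.two,
    port_of_eq_some hf.three]
  obtain ⟨a0, a1, a2, a3⟩ := a
  obtain ⟨b0, b1, b2, b3⟩ := b
  obtain ⟨⟨c0, c1⟩, c2, c3⟩ := h3
  exact ⟨a0.trans (c0.trans b0), a1, b2.trans (c3.trans a2), b3⟩

theorem HasLabelling.add_two {T : Tangle} (hT : T.HasLabelling t) : T.HasLabelling (t + 2) := by
  intro X n s w
  obtain ⟨F, hF, h0, h1, h2, h3, h⟩ := hT X s n w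
  refine ⟨F, hF, ?_⟩
  simp only [add_assoc, Fin.reduceAdd, add_zero]
  exact ⟨h2, h3, h0, h1, fun x => ⟨(h x).2, (h x).1⟩⟩

/-- The region enclosed between the parts gets the label `w`, like the two outer sides that it
separates. -/
theorem HasLabelling.paste (hA : A.HasLabelling t) (hB : B.HasLabelling t) (hA' : A.HasSides)
    (hB' : B.HasSides) (hf : IsJoin t f g) : (paste A B f g hfg hn).HasLabelling t := by
  intro X n s w
  obtain ⟨F, hF, F0, F1, F2, F3, hF'⟩ := hA X n s w
  obtain ⟨G, hG, G0, G1, G2, G3, hG'⟩ := hB X n s w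
  have a := (Fin.forall_fin_four_add t).1 (hA' X _ hF)
  have b := (Fin.forall_fin_four_add t).1 (hB' X _ hG)
  simp only [add_assoc, Fin.reduceAdd, add_zero] at a b
  refine ⟨pasteFun f g hfg hn F G, isRegionInvariant_paste.2 ⟨hF, hG, ?_⟩, ?_⟩
  · rw [hf.eq_some]
    refine ⟨⟨F0.trans (b.1.trans G0).symm, G1.trans (a.2.2.2.trans F3).symm⟩,
      F3.trans (b.2.1.trans G1).symm, G2.trans (a.2.2.1.trans F2).symm⟩
  · rw [port_of_eq_some hf.zero, port_of_eq_none hf.one, port_of_eq_none hf.two,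
      port_of_eq_some hf.three]
    exact ⟨G0, F1, F2, G3, Sum.rec hF' hG'⟩

/-- Here the enclosed region lies between the sides labelled `n` and `s`. It gets the label `n`, so
that the first part has equal labels on both of its sides. -/
theorem HasLabelling.paste_succ (hA : A.HasLabelling (t + 1)) (hB : B.HasLabelling (t + 1))
    (hA' : A.HasSides) (hB' : B.HasSides) (hf : IsJoin t f g) :
    (Tangle.paste A B f g hfg hn).HasLabelling (t + 1) := by
  intro X n s w
  obtain ⟨F, hF, F0, F1, F2, F3, hF'⟩ := hA X n n w
  obtain ⟨G, hG, G0, G1, G2, G3, hG'⟩ := hB X n s w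
  have a := (Fin.forall_fin_four_add t).1 (hA' X _ hF)
  have b := (Fin.forall_fin_four_add t).1 (hB' X _ hG)
  simp only [add_assoc, Fin.reduceAdd, add_zero] at *
  refine ⟨pasteFun f g hfg hn F G, isRegionInvariant_paste.2 ⟨hF, hG, ?_⟩, ?_⟩
  · rw [hf.eq_some]
    refine ⟨⟨F3.trans (b.1.trans G3).symm, G0.trans (a.2.2.2.trans F2).symm⟩,
      F2.trans (b.2.1.trans G0).symm, G1.trans (a.2.2.1.trans F1).symm⟩
  · rw [port_of_eq_some hf.zero, port_of_eq_none hf.one, port_of_eq_none hf.two,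
      port_of_eq_some hf.three]
    exact ⟨F0, F1, G2, G3, Sum.rec hF' hG'⟩

end Paste

theorem hasSides_single (s : Bool) : (single s).HasSides := by
  intro X F _ k
  simp [single]

theorem hasLabelling_single (s : Bool) (t : Fin 4) : (single s).HasLabelling t := by
  intro X n m w
  refine ⟨fun e => if e.2 = t then n else if e.2 = t + 2 then m else w, fun _ _ h => ?_, ?_⟩
  · cases h
  · fin_cases t <;> simp [single]

end Tangle

namespace Tangle

/-! ### Seifert circles of oriented tangles -/

namespace Orientation

variable {T : Tangle} (o : T.Orientation)

/-- A function on the ends of `T` that is constant along the Seifert circles. -/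
def IsSeifertInvariant (h : T.Crossing × Fin 4 → ZMod 2) : Prop :=
  (∀ e e', T.next e = .inl e' → h e = h e') ∧
    ∀ x i, o.out (x, i) ≠ o.out (x, i + 1) → h (x, i) = h (x, i + 1)

/-- The Seifert smoothing of `x` joins the end `t` to `t + 1` and the end `t + 2` to `t + 3`. -/
def Parallel (t : Fin 4) (x : T.Crossing) : Prop := o.out (x, t) ≠ o.out (x, t + 1)

theorem parallel_succ {t : Fin 4} {x : T.Crossing} : o.Parallel (t + 1) x ↔ ¬ o.Parallel t x := by
  unfold Parallel
  rw [add_assoc, show (1 + 1 : Fin 4) = 2 from rfl, o.out_opposite]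
  cases o.out (x, t) <;> cases o.out (x, t + 1) <;> simp

theorem parallel_add_two {t : Fin 4} {x : T.Crossing} : o.Parallel (t + 2) x ↔ o.Parallel t x := by
  rw [show t + 2 = t + 1 + 1 by rw [add_assoc]; rfl, parallel_succ, parallel_succ, not_not]

/-- The oriented tangle `T` may take the place of a crossing whose smoothing joins the end `t` to
`t + 1` and the end `t + 2` to `t + 3`, as far as the Seifert graph and the checkerboard graph are
concerned. -/
structure Resembles (t : Fin 4) : Prop where
  apply_eq : ∀ h, o.IsSeifertInvariant h →
    h (T.port t) = h (T.port (t + 1)) ∧ h (T.port (t + 2)) = h (T.port (t + 3))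
  exists_apply_eq : ∀ u v, ∃ h, o.IsSeifertInvariant h ∧ h (T.port t) = u ∧ h (T.port (t + 2)) = v
  exists_restrict : ∀ h, o.IsSeifertInvariant h → ∃ h', o.IsSeifertInvariant h' ∧
    h' (T.port t) = h (T.port t) ∧ h' (T.port (t + 2)) = h (T.port (t + 2)) ∧
    (∀ x, o.Parallel t x → h' (x, 0) - h' (x, 2) = h (x, 0) - h (x, 2)) ∧
    ∀ x, ¬ o.Parallel t x → h' (x, 0) - h' (x, 2) = 0
  apply_eq_of_parallel : ∀ h, o.IsSeifertInvariant h →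
    (∀ x, o.Parallel t x → h (x, 0) - h (x, 2) = 0) → h (T.port t) = h (T.port (t + 2))
  exists_corner : ∀ (X : Type) (F : T.Crossing × Fin 4 → X), T.IsRegionInvariant F →
    (∃ x, o.Parallel t x ∧ (F (x, t + 1) = F (T.port (t + 1)) ∨
      F (x, t + 3) = F (T.port (t + 1)))) ∧
    ∃ x, o.Parallel t x ∧ (F (x, t + 1) = F (T.port (t + 3)) ∨ F (x, t + 3) = F (T.port (t + 3)))

variable {o}

theorem IsSeifertInvariant.add {h h' : T.Crossing × Fin 4 → ZMod 2} (H : o.IsSeifertInvariant h)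
    (H' : o.IsSeifertInvariant h') : o.IsSeifertInvariant (h + h') :=
  ⟨fun e e' he => by simp [H.1 e e' he, H'.1 e e' he],
    fun x i hi => by simp [H.2 x i hi, H'.2 x i hi]⟩

theorem IsSeifertInvariant.sub {h h' : T.Crossing × Fin 4 → ZMod 2} (H : o.IsSeifertInvariant h)
    (H' : o.IsSeifertInvariant h') : o.IsSeifertInvariant (h - h') :=
  ⟨fun e e' he => by simp [H.1 e e' he, H'.1 e e' he],
    fun x i hi => by simp [H.2 x i hi, H'.2 x i hi]⟩

theorem isSeifertInvariant_const (u : ZMod 2) : o.IsSeifertInvariant fun _ => u :=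
  ⟨fun _ _ _ => rfl, fun _ _ _ => rfl⟩

/-- The complementary restriction of a function that has the same value on both sides. -/
theorem Resembles.exists_restrict_compl {t : Fin 4} (ho : o.Resembles t)
    {h : T.Crossing × Fin 4 → ZMod 2} (hh : o.IsSeifertInvariant h)
    (heq : h (T.port t) = h (T.port (t + 2))) :
    ∃ h', o.IsSeifertInvariant h' ∧ (∀ k, h' (T.port k) = h (T.port t)) ∧
      (∀ x, ¬ o.Parallel t x → h' (x, 0) - h' (x, 2) = h (x, 0) - h (x, 2)) ∧
      ∀ x, o.Parallel t x → h' (x, 0) - h' (x, 2) = 0 := by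
  obtain ⟨h', hh', h0, h2, hp, hn⟩ := ho.exists_restrict h hh
  have a := ho.apply_eq h hh
  have a' := ho.apply_eq h' hh'
  refine ⟨h - h' + fun _ => h (T.port t), (hh.sub hh').add (isSeifertInvariant_const _), ?_,
    fun x hx => ?_, fun x hx => ?_⟩
  · rw [Fin.forall_fin_four_add t]
    simp [h0, h2, ← a.1, ← a.2, ← a'.1, ← a'.2, heq]
  · have := hn x hx
    simp only [Pi.add_apply, Pi.sub_apply]
    linear_combination -this
  · have := hp x hx
    simp only [Pi.add_apply, Pi.sub_apply]
    linear_combination -this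

theorem Resembles.add_two {t : Fin 4} (ho : o.Resembles t) : o.Resembles (t + 2) := by
  constructor <;> simp only [parallel_add_two, add_assoc, Fin.reduceAdd, add_zero]
  · exact fun h hh => (ho.apply_eq h hh).symm
  · intro u v
    obtain ⟨h, hh, h0, h2⟩ := ho.exists_apply_eq v u
    exact ⟨h, hh, h2, h0⟩
  · intro h hh
    obtain ⟨h', hh', h0, h2, H⟩ := ho.exists_restrict h hh
    exact ⟨h', hh', h2, h0, H⟩
  · exact fun h hh H => (ho.apply_eq_of_parallel h hh H).symm
  · intro X F hF
    obtain ⟨⟨x, hx, hxF⟩, y, hy, hyF⟩ := ho.exists_corner X F hF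
    exact ⟨⟨y, hy, hyF.symm⟩, x, hx, hxF.symm⟩

/-! ### Resemblance to a crossing under pasting -/

section Paste

variable {A B : Tangle} {f g : Fin 4 → Option (Fin 4)}
  {hfg : ∀ k l, f k = some l ↔ g l = some k} {hn : ∀ k, f k = none ↔ g k ≠ none} {t : Fin 4}
  {o : (Tangle.paste A B f g hfg hn).Orientation}

theorem isSeifertInvariant_paste {h : (paste A B f g hfg hn).Crossing × Fin 4 → ZMod 2} :
    o.IsSeifertInvariant h ↔
      o.left.IsSeifertInvariant (fun e => h (inlEnd A B e)) ∧
      o.right.IsSeifertInvariant (fun e => h (inrEnd A B e)) ∧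
      ∀ k l, f k = some l → h (inlEnd A B (A.port k)) = h (inrEnd A B (B.port l)) := by
  constructor
  · exact fun H => ⟨⟨fun e e' he => H.1 _ _ (next_inlEnd he), fun x => H.2 (Sum.inl x)⟩,
      ⟨fun e e' he => H.1 _ _ (next_inrEnd he), fun x => H.2 (Sum.inr x)⟩,
      fun k l hk => H.1 _ _ (next_inlEnd_port hk)⟩
  · exact fun ⟨h1, h2, h3⟩ => ⟨forall_next_paste h1.1 h2.1 h3 (fun k l hk => (h3 k l hk).symm),
      Sum.rec h1.2 h2.2⟩

theorem isSeifertInvariant_pasteFun (hf : IsJoin t f g) {h : A.Crossing × Fin 4 → ZMod 2}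
    {h' : B.Crossing × Fin 4 → ZMod 2} (hh : o.left.IsSeifertInvariant h)
    (hh' : o.right.IsSeifertInvariant h') (h0 : h (A.port t) = h' (B.port (t + 1)))
    (h3 : h (A.port (t + 3)) = h' (B.port (t + 2))) :
    o.IsSeifertInvariant (pasteFun f g hfg hn h h') :=
  isSeifertInvariant_paste.2 ⟨hh, hh', hf.eq_some.2 ⟨h0, h3⟩⟩

theorem exists_pasteFun (hf : IsJoin t f g) {h : (paste A B f g hfg hn).Crossing × Fin 4 → ZMod 2}
    (hh : o.IsSeifertInvariant h) :
    ∃ hA hB, o.left.IsSeifertInvariant hA ∧ o.right.IsSeifertInvariant hB ∧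
      hA (A.port t) = hB (B.port (t + 1)) ∧ hA (A.port (t + 3)) = hB (B.port (t + 2)) ∧
      h = pasteFun f g hfg hn hA hB := by
  obtain ⟨h1, h2, h3⟩ := isSeifertInvariant_paste.1 hh
  rw [hf.eq_some] at h3
  refine ⟨_, _, h1, h2, h3.1, h3.2, ?_⟩
  ext ⟨x | x, i⟩ <;> rfl

theorem pasteFun_port (hf : IsJoin t f g) {X : Type} (F : A.Crossing × Fin 4 → X)
    (G : B.Crossing × Fin 4 → X) :
    pasteFun f g hfg hn F G ((paste A B f g hfg hn).port t) = G (B.port t) ∧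
    pasteFun f g hfg hn F G ((paste A B f g hfg hn).port (t + 1)) = F (A.port (t + 1)) ∧
    pasteFun f g hfg hn F G ((paste A B f g hfg hn).port (t + 2)) = F (A.port (t + 2)) ∧
    pasteFun f g hfg hn F G ((paste A B f g hfg hn).port (t + 3)) = G (B.port (t + 3)) := by
  rw [port_of_eq_some hf.zero, port_of_eq_none hf.one, port_of_eq_none hf.two,
    port_of_eq_some hf.three]
  exact ⟨rfl, rfl, rfl, rfl⟩

/-- The two Seifert arcs of the first part are continued by those of the second, so the parts act
like parallel edges between the same two circles. -/
theorem Resembles.paste (hA : o.left.Resembles t) (hB : o.right.Resembles t) (hf : IsJoin t f g) :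
    o.Resembles t := by
  refine ⟨fun h hh => ?_, fun u v => ?_, fun h hh => ?_, fun h hh H => ?_, fun X F hF => ?_⟩
  · obtain ⟨a, b, ha, hb, h0, h3, rfl⟩ := exists_pasteFun hf hh
    obtain ⟨p0, p1, p2, p3⟩ := pasteFun_port (hfg := hfg) (hn := hn) hf a b
    rw [p0, p1, p2, p3]
    have a' := hA.apply_eq a ha
    have b' := hB.apply_eq b hb
    exact ⟨b'.1.trans (h0.symm.trans a'.1), a'.2.trans (h3.trans b'.2)⟩
  · obtain ⟨a, ha, a0, a2⟩ := hA.exists_apply_eq u v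
    obtain ⟨b, hb, b0, b2⟩ := hB.exists_apply_eq u v
    have a' := hA.apply_eq a ha
    have b' := hB.apply_eq b hb
    obtain ⟨p0, p1, p2, p3⟩ := pasteFun_port (hfg := hfg) (hn := hn) hf a b
    refine ⟨_, isSeifertInvariant_pasteFun hf ha hb ?_ ?_, p0.trans b0, p2.trans a2⟩
    · rw [← b'.1, a0, b0]
    · rw [← a'.2, a2, b2]
  · obtain ⟨a, b, ha, hb, h0, h3, rfl⟩ := exists_pasteFun hf hh
    obtain ⟨p0, p1, p2, p3⟩ := pasteFun_port (hfg := hfg) (hn := hn) hf a b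
    obtain ⟨a₁, ha₁, a0, a2, aP, aN⟩ := hA.exists_restrict a ha
    obtain ⟨b₁, hb₁, b0, b2, bP, bN⟩ := hB.exists_restrict b hb
    obtain ⟨q0, q1, q2, q3⟩ := pasteFun_port (hfg := hfg) (hn := hn) hf a₁ b₁
    refine ⟨_, isSeifertInvariant_pasteFun hf ha₁ hb₁ ?_ ?_, by rw [p0, q0, b0],
      by rw [p2, q2, a2], Sum.rec aP bP, Sum.rec aN bN⟩
    · rw [a0, h0, ← (hB.apply_eq b hb).1, ← (hB.apply_eq b₁ hb₁).1, b0]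
    · rw [b2, ← h3, ← (hA.apply_eq a ha).2, ← (hA.apply_eq a₁ ha₁).2, a2]
  · obtain ⟨a, b, ha, hb, h0, h3, rfl⟩ := exists_pasteFun hf hh
    obtain ⟨p0, p1, p2, p3⟩ := pasteFun_port (hfg := hfg) (hn := hn) hf a b
    rw [p0, p2, (hB.apply_eq b hb).1, ← h0]
    exact hA.apply_eq_of_parallel a ha fun x => H (.inl x)
  · obtain ⟨h1, h2, h3⟩ := isRegionInvariant_paste.1 hF
    obtain ⟨x, hx, hxF⟩ := (hA.exists_corner X _ h1).1
    obtain ⟨y, hy, hyF⟩ := (hB.exists_corner X _ h2).2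
    rw [port_of_eq_none hf.one, port_of_eq_some hf.three]
    exact ⟨⟨.inl x, hx, hxF⟩, .inr y, hy, hyF⟩

/-- The sides `t` of the two parts are in the same region, and so are the sides `t + 2`. -/
theorem _root_.Tangle.IsRegionInvariant.paste_sides (hA : A.HasSides) (hB : B.HasSides)
    (hf : IsJoin t f g) {X : Type} {F : (Tangle.paste A B f g hfg hn).Crossing × Fin 4 → X}
    (hF : (Tangle.paste A B f g hfg hn).IsRegionInvariant F) :
    F (inlEnd A B (A.port t)) = F (inrEnd A B (B.port t)) ∧
      F (inlEnd A B (A.port (t + 2))) = F (inrEnd A B (B.port (t + 2))) := by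
  obtain ⟨h1, h2, h3⟩ := isRegionInvariant_paste.1 hF
  rw [hf.eq_some] at h3
  have a := hA X _ h1 (t + 2)
  have b := hB X _ h2 t
  rw [add_assoc, show (2 + 1 : Fin 4) = 3 from rfl] at a
  exact ⟨h3.1.1.trans b, a.symm.trans h3.2.2.symm⟩

/-- The inner arcs of the two parts close up to a circle between them, and the parts act like edges
in series. Both outer regions in question already touch the first part. -/
theorem Resembles.paste_succ (hA : o.left.Resembles (t + 1)) (hB : o.right.Resembles (t + 1))
    (sA : A.HasSides) (sB : B.HasSides) (hf : IsJoin t f g) :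
    o.Resembles (t + 1) := by
  obtain ⟨a1, a2, a3, a4, a5⟩ := hA
  obtain ⟨b1, b2, b3, b4, b5⟩ := hB
  simp only [add_assoc, Fin.reduceAdd, add_zero] at a1 a2 a3 a4 a5 b1 b2 b3 b4 b5
  constructor <;> simp only [add_assoc, Fin.reduceAdd, add_zero]
  · intro h hh
    obtain ⟨a, b, ha, hb, h0, h3, rfl⟩ := exists_pasteFun hf hh
    obtain ⟨p0, p1, p2, p3⟩ := pasteFun_port (hfg := hfg) (hn := hn) hf a b
    rw [p0, p1, p2, p3]
    exact ⟨(a1 a ha).1, (b1 b hb).2⟩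
  · intro u v
    obtain ⟨a, ha, a0, a2⟩ := a2 u u
    obtain ⟨b, hb, b0, b2⟩ := b2 u v
    have a' := a1 a ha
    have b' := b1 b hb
    obtain ⟨p0, p1, p2, p3⟩ := pasteFun_port (hfg := hfg) (hn := hn) hf a b
    refine ⟨_, isSeifertInvariant_pasteFun hf ha hb ?_ ?_, p1.trans a0, p3.trans b2⟩
    · rw [← a'.2, a2, b0]
    · rw [← b'.1, a2, b0]
  · intro h hh
    obtain ⟨a, b, ha, hb, h0, h3, rfl⟩ := exists_pasteFun hf hh
    obtain ⟨p0, p1, p2, p3⟩ := pasteFun_port (hfg := hfg) (hn := hn) hf a b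
    obtain ⟨a₁, ha₁, a0, a2, aP, aN⟩ := a3 a ha
    obtain ⟨b₁, hb₁, b0, b2, bP, bN⟩ := b3 b hb
    obtain ⟨q0, q1, q2, q3⟩ := pasteFun_port (hfg := hfg) (hn := hn) hf a₁ b₁
    have e : a₁ (A.port (t + 3)) = b₁ (B.port (t + 2)) := by
      rw [a2, h3, ← (b1 b hb).1, ← (b1 b₁ hb₁).1, b0]
    refine ⟨_, isSeifertInvariant_pasteFun hf ha₁ hb₁ ?_ e, by rw [p1, q1, a0],
      by rw [p3, q3, b2], Sum.rec aP bP, Sum.rec aN bN⟩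
    rw [← (a1 a₁ ha₁).2, e, ← (b1 b₁ hb₁).1]
  · intro h hh H
    obtain ⟨a, b, ha, hb, h0, h3, rfl⟩ := exists_pasteFun hf hh
    obtain ⟨p0, p1, p2, p3⟩ := pasteFun_port (hfg := hfg) (hn := hn) hf a b
    rw [p1, p3, a4 a ha fun x => H (.inl x), h3, ← (b1 b hb).1]
    exact b4 b hb fun x => H (.inr x)
  · intro X F hF
    obtain ⟨h1, h2, h3⟩ := isRegionInvariant_paste.1 hF
    obtain ⟨⟨x, hx, hxF⟩, y, hy, hyF⟩ := a5 X _ h1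
    rw [port_of_eq_none hf.two, port_of_eq_some hf.zero, ← (hF.paste_sides sA sB hf).1]
    exact ⟨⟨.inl x, hx, hxF⟩, .inl y, hy, hyF⟩

/-- Both arcs of the second part continue the same arc of the first, so the second part hangs on a
single Seifert circle and affects only the way in which functions are restricted. -/
theorem Resembles.paste_left (hA : o.left.Resembles (t + 1)) (hB : o.right.Resembles t)
    (sA : A.HasSides) (sB : B.HasSides) (hf : IsJoin t f g) :
    o.Resembles (t + 1) := by
  obtain ⟨a1, a2, a3, a4, a5⟩ := hA
  simp only [add_assoc, Fin.reduceAdd, add_zero] at a1 a2 a3 a4 a5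
  constructor <;> simp only [add_assoc, Fin.reduceAdd, add_zero]
  · intro h hh
    obtain ⟨a, b, ha, hb, h0, h3, rfl⟩ := exists_pasteFun hf hh
    obtain ⟨p0, p1, p2, p3⟩ := pasteFun_port (hfg := hfg) (hn := hn) hf a b
    rw [p0, p1, p2, p3, ← (hB.apply_eq b hb).2, (hB.apply_eq b hb).1, ← h0, ← h3]
    exact a1 a ha
  · intro u v
    obtain ⟨a, ha, a0, a2⟩ := a2 u v
    obtain ⟨p0, p1, p2, p3⟩ := pasteFun_port (hfg := hfg) (hn := hn) hf a fun _ => v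
    exact ⟨_, isSeifertInvariant_pasteFun hf ha (isSeifertInvariant_const v)
      ((a1 a ha).2.symm.trans a2) a2, p1.trans a0, p3⟩
  · intro h hh
    obtain ⟨a, b, ha, hb, h0, h3, rfl⟩ := exists_pasteFun hf hh
    obtain ⟨p0, p1, p2, p3⟩ := pasteFun_port (hfg := hfg) (hn := hn) hf a b
    obtain ⟨a₁, ha₁, a0, a2, aP, aN⟩ := a3 a ha
    have e0 : b (B.port t) = a (A.port (t + 3)) := by
      rw [(hB.apply_eq b hb).1, ← h0, (a1 a ha).2]
    have e2 : b (B.port (t + 2)) = a (A.port (t + 3)) := h3.symm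
    -- In the second part the crossings to be kept are those not parallel with respect to `t`, hence
    -- the complementary restriction.
    obtain ⟨b₁, hb₁, bc, bN, bP⟩ := hB.exists_restrict_compl hb (e0.trans e2.symm)
    obtain ⟨q0, q1, q2, q3⟩ := pasteFun_port (hfg := hfg) (hn := hn) hf a₁ b₁
    refine ⟨_, isSeifertInvariant_pasteFun hf ha₁ hb₁ ?_ ?_, by rw [p1, q1, a0],
      by rw [p3, q3, bc, e0, ← (hB.apply_eq b hb).2, e2], ?_, ?_⟩
    · rw [← (a1 a₁ ha₁).2, a2, bc, e0]
    · rw [a2, bc, e0]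
    · exact Sum.rec aP fun x hx => bN x (o.right.parallel_succ.1 hx)
    · exact Sum.rec aN fun x hx => bP x (not_not.1 fun h => hx (o.right.parallel_succ.2 h))
  · intro h hh H
    obtain ⟨a, b, ha, hb, h0, h3, rfl⟩ := exists_pasteFun hf hh
    obtain ⟨p0, p1, p2, p3⟩ := pasteFun_port (hfg := hfg) (hn := hn) hf a b
    rw [p1, p3, a4 a ha fun x => H (.inl x), h3, (hB.apply_eq b hb).2]
  · intro X F hF
    obtain ⟨h1, h2, h3⟩ := isRegionInvariant_paste.1 hF
    obtain ⟨⟨x, hx, hxF⟩, y, hy, hyF⟩ := a5 X _ h1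
    rw [port_of_eq_none hf.two, port_of_eq_some hf.zero, ← (hF.paste_sides sA sB hf).1]
    exact ⟨⟨.inl x, hx, hxF⟩, .inl y, hy, hyF⟩

/-- The mirror image of `Resembles.paste_left`: now the first part hangs on a single Seifert circle
of the second. -/
theorem Resembles.paste_right (hA : o.left.Resembles t) (hB : o.right.Resembles (t + 1))
    (sA : A.HasSides) (sB : B.HasSides) (hf : IsJoin t f g) :
    o.Resembles (t + 1) := by
  obtain ⟨b1, b2, b3, b4, b5⟩ := hB
  simp only [add_assoc, Fin.reduceAdd, add_zero] at b1 b2 b3 b4 b5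
  constructor <;> simp only [add_assoc, Fin.reduceAdd, add_zero]
  · intro h hh
    obtain ⟨a, b, ha, hb, h0, h3, rfl⟩ := exists_pasteFun hf hh
    obtain ⟨p0, p1, p2, p3⟩ := pasteFun_port (hfg := hfg) (hn := hn) hf a b
    rw [p0, p1, p2, p3, (hA.apply_eq a ha).2, ← (hA.apply_eq a ha).1, h0, h3]
    exact ⟨(b1 b hb).1, (b1 b hb).2⟩
  · intro u v
    obtain ⟨b, hb, b0, b2⟩ := b2 u v
    obtain ⟨p0, p1, p2, p3⟩ := pasteFun_port (hfg := hfg) (hn := hn) hf (fun _ => u) b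
    exact ⟨_, isSeifertInvariant_pasteFun hf (isSeifertInvariant_const u) hb b0.symm
      (b0.symm.trans (b1 b hb).1), p1, p3.trans b2⟩
  · intro h hh
    obtain ⟨a, b, ha, hb, h0, h3, rfl⟩ := exists_pasteFun hf hh
    obtain ⟨p0, p1, p2, p3⟩ := pasteFun_port (hfg := hfg) (hn := hn) hf a b
    obtain ⟨b₁, hb₁, b0, b2, bP, bN⟩ := b3 b hb
    have e2 : a (A.port (t + 2)) = a (A.port t) := by
      rw [(hA.apply_eq a ha).2, h3, h0, (b1 b hb).1]
    obtain ⟨a₁, ha₁, ac, aN, aP⟩ := hA.exists_restrict_compl ha e2.symm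
    obtain ⟨q0, q1, q2, q3⟩ := pasteFun_port (hfg := hfg) (hn := hn) hf a₁ b₁
    refine ⟨_, isSeifertInvariant_pasteFun hf ha₁ hb₁ ?_ ?_,
      by rw [p1, q1, ac, (hA.apply_eq a ha).1], by rw [p3, q3, b2], ?_, ?_⟩
    · rw [ac, h0, b0]
    · rw [ac, h0, ← b0, (b1 b₁ hb₁).1]
    · exact Sum.rec (fun x hx => aN x (o.left.parallel_succ.1 hx)) bP
    · exact Sum.rec (fun x hx => aP x (not_not.1 fun h => hx (o.left.parallel_succ.2 h))) bN
  · intro h hh H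
    obtain ⟨a, b, ha, hb, h0, h3, rfl⟩ := exists_pasteFun hf hh
    obtain ⟨p0, p1, p2, p3⟩ := pasteFun_port (hfg := hfg) (hn := hn) hf a b
    rw [p1, p3, ← b4 b hb fun x => H (.inr x), ← h0, (hA.apply_eq a ha).1]
  · intro X F hF
    obtain ⟨h1, h2, h3⟩ := isRegionInvariant_paste.1 hF
    obtain ⟨⟨x, hx, hxF⟩, y, hy, hyF⟩ := b5 X _ h2
    rw [port_of_eq_none hf.two, port_of_eq_some hf.zero, (hF.paste_sides sA sB hf).2]
    exact ⟨⟨.inr x, hx, hxF⟩, .inr y, hy, hyF⟩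

end Paste

/-! ### The invariant of the induction -/

variable (o) in
/-- The strands run from the end points `t`, `t + 3` to `t + 1`, `t + 2` or in the opposite
direction. -/
def Flows (t : Fin 4) : Prop :=
  o.out (T.port (t + 3)) = o.out (T.port t) ∧ o.out (T.port (t + 2)) = o.out (T.port (t + 1)) ∧
    o.out (T.port t) ≠ o.out (T.port (t + 1))

variable (o) in
/-- The orientations at the four end points alternate. -/
def Alternates (t : Fin 4) : Prop :=
  o.out (T.port (t + 2)) = o.out (T.port t) ∧ o.out (T.port (t + 3)) = o.out (T.port (t + 1)) ∧
    o.out (T.port t) ≠ o.out (T.port (t + 1))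

variable (o) in
/-- Up to the directions of the edges, the tangle resembles a crossing whose smoothing is
compatible with the orientations at the end points. -/
structure IsAdmissible (t : Fin 4) : Prop where
  cases : o.Flows t ∨ o.Flows (t + 1) ∨ o.Alternates t
  resembles : o.Flows t → o.Resembles t
  resembles_succ : o.Flows (t + 1) → o.Resembles (t + 1)
  resembles_or : o.Resembles t ∨ o.Resembles (t + 1)

/-- A rotation by two ends changes nothing, so admissibility treats `t` and `t + 1` symmetrically.
This frees the induction from the choice of `t`. -/
theorem IsAdmissible.succ {t : Fin 4} (h : o.IsAdmissible t) : o.IsAdmissible (t + 1) := by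
  have e : t + 1 + 1 = t + 2 := by rw [add_assoc]; rfl
  have hF : o.Flows (t + 2) → o.Flows t := by
    unfold Flows
    simp only [add_assoc, Fin.reduceAdd, add_zero]
    generalize o.out (T.port t) = a; generalize o.out (T.port (t + 1)) = b
    generalize o.out (T.port (t + 2)) = c; generalize o.out (T.port (t + 3)) = d
    revert a b c d; decide
  have hF' : o.Flows t → o.Flows (t + 2) := by
    unfold Flows
    simp only [add_assoc, Fin.reduceAdd, add_zero]
    generalize o.out (T.port t) = a; generalize o.out (T.port (t + 1)) = b
    generalize o.out (T.port (t + 2)) = c; generalize o.out (T.port (t + 3)) = d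
    revert a b c d; decide
  have hA : o.Alternates t → o.Alternates (t + 1) := by
    unfold Alternates
    simp only [add_assoc, Fin.reduceAdd, add_zero]
    generalize o.out (T.port t) = a; generalize o.out (T.port (t + 1)) = b
    generalize o.out (T.port (t + 2)) = c; generalize o.out (T.port (t + 3)) = d
    revert a b c d; decide
  refine ⟨?_, h.resembles_succ, ?_, ?_⟩ <;> rw [e]
  · rcases h.cases with h | h | h
    · exact .inr (.inl (hF' h))
    · exact .inl h
    · exact .inr (.inr (hA h))
  · exact fun h' => (h.resembles (hF h')).add_two
  · exact h.resembles_or.symm.imp_right fun h => h.add_two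

theorem IsAdmissible.of_eq {t t' : Fin 4} (h : o.IsAdmissible t) : o.IsAdmissible t' := by
  have h2 := h.succ.succ
  have h3 := h.succ.succ.succ
  rw [add_assoc] at h2 h3
  rw [add_assoc] at h3
  exact (Fin.forall_fin_four_add t).2 ⟨h, h.succ, h2, h3⟩ t'

theorem IsAdmissible.paste {A B : Tangle} {f g : Fin 4 → Option (Fin 4)}
    {hfg : ∀ k l, f k = some l ↔ g l = some k} {hn : ∀ k, f k = none ↔ g k ≠ none} {t : Fin 4}
    {o : (Tangle.paste A B f g hfg hn).Orientation} (sA : A.HasSides) (sB : B.HasSides)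
    (hf : IsJoin t f g) (hA : o.left.IsAdmissible t) (hB : o.right.IsAdmissible t) :
    o.IsAdmissible t := by
  have c0 : o.right.out (B.port (t + 1)) = !o.left.out (A.port t) :=
    o.out_next _ _ (next_inlEnd_port hf.zero)
  have c3 : o.right.out (B.port (t + 2)) = !o.left.out (A.port (t + 3)) :=
    o.out_next _ _ (next_inlEnd_port hf.three)
  have p0 : o.out ((Tangle.paste A B f g hfg hn).port t) = o.right.out (B.port t) := by
    rw [port_of_eq_some hf.zero]; rfl
  have p1 : o.out ((Tangle.paste A B f g hfg hn).port (t + 1)) = o.left.out (A.port (t + 1)) := by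
    rw [port_of_eq_none hf.one]; rfl
  have p2 : o.out ((Tangle.paste A B f g hfg hn).port (t + 2)) = o.left.out (A.port (t + 2)) := by
    rw [port_of_eq_none hf.two]; rfl
  have p3 : o.out ((Tangle.paste A B f g hfg hn).port (t + 3)) = o.right.out (B.port (t + 3)) := by
    rw [port_of_eq_some hf.three]; rfl
  -- A flow across the seam passes through both parts. A flow along the seam is only forced in one
  -- of the parts; the direction of the other is then immaterial.
  have flow : (o.Flows t ∨ o.Flows (t + 1) ∨ o.Alternates t) ∧
      (o.Flows t → o.left.Flows t ∧ o.right.Flows t) ∧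
      (o.Flows (t + 1) → o.left.Flows (t + 1) ∨ o.right.Flows (t + 1)) := by
    have hA' := hA.cases
    have hB' := hB.cases
    revert hA' hB'
    unfold Flows Alternates
    simp only [add_assoc, Fin.reduceAdd, add_zero, p0, p1, p2, p3, c0, c3]
    generalize o.left.out (A.port t) = a0; generalize o.left.out (A.port (t + 1)) = a1
    generalize o.left.out (A.port (t + 2)) = a2; generalize o.left.out (A.port (t + 3)) = a3
    generalize o.right.out (B.port t) = b0; generalize o.right.out (B.port (t + 3)) = b3
    cases a0 <;> cases a1 <;> cases a2 <;> cases a3 <;> cases b0 <;> cases b3 <;> simp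
  have left : o.left.Resembles (t + 1) → o.Resembles (t + 1) := fun h =>
    hB.resembles_or.elim (fun h' => h.paste_left h' sA sB hf) fun h' => h.paste_succ h' sA sB hf
  have right : o.right.Resembles (t + 1) → o.Resembles (t + 1) := fun h =>
    hA.resembles_or.elim (fun h' => h'.paste_right h sA sB hf) fun h' => h'.paste_succ h sA sB hf
  refine ⟨flow.1, fun h => ?_, fun h => ?_, ?_⟩
  · exact (hA.resembles (flow.2.1 h).1).paste (hB.resembles (flow.2.1 h).2) hf
  · exact (flow.2.2 h).elim (fun h => left (hA.resembles_succ h))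
      fun h => right (hB.resembles_succ h)
  · exact hA.resembles_or.elim (fun h => hB.resembles_or.imp (fun h' => h.paste h' hf) right)
      fun h => .inr (left h)

theorem resembles_single {s : Bool} {o : (single s).Orientation} {t : Fin 4}
    {x : (single s).Crossing} (h : o.Parallel t x) : o.Resembles t := by
  have h' : o.Parallel (t + 2) x := o.parallel_add_two.2 h
  have hports : ∀ k, (single s).port k = (x, k) := fun _ => rfl
  have huniq : ∀ y : (single s).Crossing, y = x := fun _ => rfl
  have hneg : ∀ a b : ZMod 2, a - b = b - a := by decide
  have key : ∀ h : (single s).Crossing × Fin 4 → ZMod 2, o.IsSeifertInvariant h →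
      h (x, t) = h (x, t + 1) ∧ h (x, t + 2) = h (x, t + 3) := by
    intro f hf
    have h2 := hf.2 x (t + 2) h'
    rw [add_assoc] at h2
    exact ⟨hf.2 x t h, h2⟩
  constructor
  · exact key
  · intro u v
    refine ⟨fun e => if e.2 = t ∨ e.2 = t + 1 then u else v,
      ⟨fun _ _ h => ?_, fun y i hi => ?_⟩, ?_⟩
    · cases h
    · rw [huniq y] at hi
      have hi' : i = t ∨ i = t + 2 := by
        by_contra hc
        have e : i = t + 1 ∨ i = t + 2 + 1 :=
          (by decide : ∀ i t : Fin 4, ¬ (i = t ∨ i = t + 2) → i = t + 1 ∨ i = t + 2 + 1) i t hc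
        rcases e with rfl | rfl
        · exact o.parallel_succ.1 hi h
        · exact o.parallel_succ.1 hi h'
      have := (by decide : ∀ i t : Fin 4, i = t ∨ i = t + 2 →
        ((i = t ∨ i = t + 1) ↔ (i + 1 = t ∨ i + 1 = t + 1))) i t hi'
      simp only [this]
    · simp [hports]
  · exact fun f hf => ⟨f, hf, rfl, rfl, fun _ _ => rfl, fun y hy => (hy (huniq y ▸ h)).elim⟩
  · intro f hf H
    have h0 := H x h
    obtain ⟨k1, k2⟩ := key f hf
    rw [hports, hports, ← sub_eq_zero]
    refine Eq.trans ?_ h0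
    have e : ∀ t : Fin 4, t = 0 ∨ t = 1 ∨ t = 2 ∨ t = 3 := by decide
    clear h0 H key
    rcases e t with rfl | rfl | rfl | rfl <;> simp only [zero_add, Fin.reduceAdd] at k1 k2 ⊢
    · rw [k1, k2, hneg]
    · exact hneg _ _
    · rw [k1, k2]
  · exact fun X F _ => ⟨⟨x, h, .inl rfl⟩, x, h, .inr rfl⟩

theorem isAdmissible_single {s : Bool} (o : (single s).Orientation) : o.IsAdmissible 0 := by
  obtain ⟨x, hports⟩ : ∃ x : (single s).Crossing, ∀ k, (single s).port k = (x, k) :=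
    ⟨(), fun _ => rfl⟩
  have h2 := o.out_opposite x 0
  have h3 := o.out_opposite x 1
  have flow : (o.Flows 0 ∨ o.Flows 1 ∨ o.Alternates 0) ∧
      (o.Flows 0 → o.Parallel 0 x) ∧ (o.Flows 1 → o.Parallel 1 x) := by
    unfold Flows Alternates Parallel
    simp only [zero_add, Fin.reduceAdd, hports] at h2 h3 ⊢
    rw [h2, h3]
    generalize o.out (x, 0) = a
    generalize o.out (x, 1) = b
    revert a b
    decide
  refine ⟨flow.1, fun h => resembles_single (flow.2.1 h), fun h => resembles_single (flow.2.2 h),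
    ?_⟩
  by_cases h : o.Parallel 0 x
  · exact .inl (resembles_single h)
  · exact .inr (resembles_single (o.parallel_succ.2 h))

theorem _root_.TangleBlock.isAdmissible {s : Bool} {b : TangleBlock} (hb : b.Extends s) :
    b.toTangle.HasSides ∧ ∀ (o : b.toTangle.Orientation) t, o.IsAdmissible t := by
  have H : ∀ t A B f g hfg hn, IsJoin t f g →
      (A.HasSides ∧ ∀ (o : A.Orientation) t, o.IsAdmissible t) →
      (B.HasSides ∧ ∀ (o : B.Orientation) t, o.IsAdmissible t) →
      ((Tangle.paste A B f g hfg hn).HasSides ∧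
        ∀ (o : (Tangle.paste A B f g hfg hn).Orientation) t, o.IsAdmissible t) :=
    fun t A B f g hfg hn hf hA hB => ⟨hA.1.paste hB.1 hf, fun o t' =>
      (IsAdmissible.paste hA.1 hB.1 hf (hA.2 _ t) (hB.2 _ t)).of_eq⟩
  refine TangleBlock.toTangle_induction
    (P := fun T => T.HasSides ∧ ∀ (o : T.Orientation) t, o.IsAdmissible t)
    ⟨hasSides_single s, fun o t => (isAdmissible_single o).of_eq⟩
    -- A sum is the join in position 0, and a product is the join in position 3.
    (fun A B => H 0 A B _ _ _ _ ⟨rfl, rfl, rfl, rfl, rfl, rfl, rfl, rfl⟩)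
    (fun A B => H 3 A B _ _ _ _ ⟨rfl, rfl, rfl, rfl, rfl, rfl, rfl, rfl⟩) b hb

end Orientation

theorem _root_.TangleBlock.hasLabelling {s : Bool} {b : TangleBlock} (hb : b.Extends s)
    (t : Fin 4) : b.toTangle.HasLabelling t := by
  have H : ∀ t A B f g hfg hn, IsJoin t f g → (A.HasSides ∧ ∀ t, A.HasLabelling t) →
      (B.HasSides ∧ ∀ t, B.HasLabelling t) → ((Tangle.paste A B f g hfg hn).HasSides ∧
        ∀ t, (Tangle.paste A B f g hfg hn).HasLabelling t) := by
    intro t A B f g hfg hn hf hA hB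
    refine ⟨hA.1.paste hB.1 hf, (Fin.forall_fin_four_add t).2 ?_⟩
    have h0 : (Tangle.paste A B f g hfg hn).HasLabelling t :=
      (hA.2 t).paste (hB.2 t) hA.1 hB.1 hf
    have h1 : (Tangle.paste A B f g hfg hn).HasLabelling (t + 1) :=
      (hA.2 _).paste_succ (hB.2 _) hA.1 hB.1 hf
    have h3 := h1.add_two
    rw [add_assoc] at h3
    exact ⟨h0, h1, h0.add_two, h3⟩
  exact (TangleBlock.toTangle_induction (P := fun T => T.HasSides ∧ ∀ t, T.HasLabelling t)
    ⟨hasSides_single s, hasLabelling_single s⟩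
    (fun A B => H 0 A B _ _ _ _ ⟨rfl, rfl, rfl, rfl, rfl, rfl, rfl, rfl⟩)
    (fun A B => H 3 A B _ _ _ _ ⟨rfl, rfl, rfl, rfl, rfl, rfl, rfl, rfl⟩) b hb).2 t

/-- Sums and products do not turn their parts, so the plane sign of every crossing remains `s`. -/
theorem _root_.TangleBlock.isOver_zero {s : Bool} {b : TangleBlock} (hb : b.Extends s) :
    ∀ x, b.toTangle.isOver (x, 0) = s :=
  TangleBlock.toTangle_induction (P := fun T => ∀ x, T.isOver (x, 0) = s) (fun _ => rfl)
    (fun _ _ hA hB => Sum.rec hA hB) (fun _ _ hA hB => Sum.rec hA hB) b hb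

end Tangle

/-! ## Replacement of a crossing -/

namespace OrientedDiagram

variable {D : OrientedDiagram} {c : D.Crossing} {r : Fin 4} {T : Tangle} {o : T.Orientation}
  {ho : D.Fits c r T o} {t : Fin 4}

theorem placeEnd_self (k : Fin 4) :
    D.placeEnd c r T (c, k + r) = (Sum.inr (T.port k).1, (T.port k).2) := by
  simp [placeEnd]

theorem placeEnd_of_ne {x : D.Crossing} (h : x ≠ c) (i : Fin 4) :
    D.placeEnd c r T (x, i) = (Sum.inl ⟨x, h⟩, i) := by
  simp [placeEnd, h]

/-- A function on the ends of the new diagram, given by functions on the ends of the old one and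
of the tangle. -/
def replaceFun (ho : D.Fits c r T o) (h : D.Crossing × Fin 4 → ZMod 2)
    (h' : T.Crossing × Fin 4 → ZMod 2) : (D.replace c r T o ho).Crossing × Fin 4 → ZMod 2 :=
  fun e => Sum.elim (fun x => h (x.1, e.2)) (fun y => h' (y, e.2)) e.1

theorem isSeifertInvariant_replaceFun {h : D.Crossing × Fin 4 → ZMod 2}
    {h' : T.Crossing × Fin 4 → ZMod 2} (hh : D.IsSeifertInvariant h) (hh' : o.IsSeifertInvariant h')
    (heq : ∀ k, h' (T.port k) = h (c, k + r)) :
    (D.replace c r T o ho).IsSeifertInvariant (replaceFun ho h h') := by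
  have key : ∀ e, replaceFun ho h h' (D.placeEnd c r T e) = h e := by
    rintro ⟨x, i⟩
    by_cases hx : x = c
    · subst hx
      obtain ⟨k, rfl⟩ : ∃ k, i = k + r := ⟨i - r, by simp⟩
      rw [placeEnd_self]
      exact heq k
    · rw [placeEnd_of_ne hx]
      rfl
  constructor
  · rintro ⟨x | y, i⟩
    · exact (key _).trans (hh.1 (x.1, i))
    · rcases hy : T.next (y, i) with e | k
      · have : (D.replace c r T o ho).glue (Sum.inr y, i) = (Sum.inr e.1, e.2) := by
          simp [replace, replaceGlue, hy]
        rw [this]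
        exact (hh'.1 _ _ hy).symm
      · have : (D.replace c r T o ho).glue (Sum.inr y, i) =
            D.placeEnd c r T (D.glue (c, k + r)) := by
          simp [replace, replaceGlue, hy]
        rw [this, key, hh.1, ← heq, T.port_of_next _ _ hy]
        rfl
  · rintro (x | y) i hi
    · exact hh.2 x.1 i hi
    · exact hh'.2 y i hi

/-- The end of the new diagram given by an end of the tangle. -/
def tangleEnd (ho : D.Fits c r T o) (e : T.Crossing × Fin 4) :
    (D.replace c r T o ho).Crossing × Fin 4 := (Sum.inr e.1, e.2)

/-- The end of the new diagram that corresponds to an end of the old one. -/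
noncomputable def diagramEnd (ho : D.Fits c r T o) (e : D.Crossing × Fin 4) :
    (D.replace c r T o ho).Crossing × Fin 4 := D.placeEnd c r T e

theorem diagramEnd_self (k : Fin 4) : diagramEnd ho (c, k + r) = tangleEnd ho (T.port k) :=
  placeEnd_self k

/-- A crossing of the old diagram other than `c`, in the new diagram. -/
def oldCrossing (ho : D.Fits c r T o) {x : D.Crossing} (h : x ≠ c) :
    (D.replace c r T o ho).Crossing := Sum.inl ⟨x, h⟩

theorem diagramEnd_of_ne {x : D.Crossing} (h : x ≠ c) (i : Fin 4) :
    diagramEnd ho (x, i) = (oldCrossing ho h, i) :=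
  placeEnd_of_ne h i

theorem glue_diagramEnd (e : D.Crossing × Fin 4) :
    (D.replace c r T o ho).glue (diagramEnd ho e) = diagramEnd ho (D.glue e) :=
  replaceGlue_placeEnd D c r T e

theorem glue_tangleEnd {e e' : T.Crossing × Fin 4} (he : T.next e = .inl e') :
    (D.replace c r T o ho).glue (tangleEnd ho e) = tangleEnd ho e' := by
  simp [replace, replaceGlue, tangleEnd, he]

theorem IsSeifertInvariant.tangle {h : (D.replace c r T o ho).Crossing × Fin 4 → ZMod 2}
    (hh : (D.replace c r T o ho).IsSeifertInvariant h) :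
    o.IsSeifertInvariant fun e => h (tangleEnd ho e) := by
  constructor
  · intro e e' he
    beta_reduce
    rw [← glue_tangleEnd he, hh.1]
  · exact fun y i hi => hh.2 (Sum.inr y) i hi

/-- Inside the tangle the Seifert arcs join the end points in the same pairs as the smoothing of `c`
does, so values at the ends of `c` can be read off at the end points. -/
theorem IsSeifertInvariant.diagram (hT : o.Resembles t) (hfl : o.Flows t)
    {h : (D.replace c r T o ho).Crossing × Fin 4 → ZMod 2}
    (hh : (D.replace c r T o ho).IsSeifertInvariant h) :
    D.IsSeifertInvariant fun e => h (diagramEnd ho e) := by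
  constructor
  · intro e
    beta_reduce
    rw [← glue_diagramEnd, hh.1]
  · intro x i hi
    beta_reduce
    by_cases hx : x = c
    · subst hx
      obtain ⟨k, rfl⟩ : ∃ k, i = k + r := ⟨i - r, by simp⟩
      rw [add_right_comm] at hi ⊢
      rw [diagramEnd_self, diagramEnd_self]
      rw [← ho, ← ho] at hi
      have H := hT.apply_eq _ hh.tangle
      have : ∀ k, o.out (T.port k) ≠ o.out (T.port (k + 1)) → k = t ∨ k = t + 2 := by
        obtain ⟨f1, f2, f3⟩ := hfl
        rw [Fin.forall_fin_four_add t]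
        simp only [add_assoc, Fin.reduceAdd, add_zero]
        simp [f1, f2]
      rcases this k hi with rfl | rfl
      · exact H.1
      · rw [add_assoc]
        exact H.2
    · rw [diagramEnd_of_ne hx, diagramEnd_of_ne hx]
      exact hh.2 (oldCrossing ho hx) i hi

/-- The crossing `c` is smoothed in the direction in which the orientation flows through the
tangle. -/
theorem out_ne_of_flows (ho : D.Fits c r T o) (hfl : o.Flows t) :
    D.out (c, t + r) ≠ D.out (c, t + r + 1) := by
  have := hfl.2.2
  rwa [ho, ho, add_right_comm] at this

/-- With the over-strands at `y` and `c` in the same position, a quarter turn of the smoothing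
direction exchanges over and under at the decisive end, and so reverses the sign. -/
theorem isPositive_inr_iff (hfl : o.Flows t) (hover : ∀ y, T.isOver (y, 0) = D.planeSign c r)
    (y : T.Crossing) :
    ((D.replace c r T o ho).IsPositive (Sum.inr y) ↔ D.IsPositive c) ↔ o.Parallel t y := by
  have hk : ∀ k, T.isOver (y, k) = D.isOver (c, k + r) := by
    have h0 : T.isOver (y, 0) = D.isOver (c, 0 + r) := by rw [hover, zero_add]; rfl
    have hs : ∀ k, T.isOver (y, k) = D.isOver (c, k + r) →
        T.isOver (y, k + 1) = D.isOver (c, k + 1 + r) := fun k hk => by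
      rw [add_right_comm, T.isOver_succ, D.isOver_succ, hk]
    rw [Fin.forall_fin_four_add 0]
    exact ⟨h0, hs _ h0, hs _ (hs _ h0), hs _ (hs _ (hs _ h0))⟩
  rw [isPositive_iff (out_ne_of_flows ho hfl), add_right_comm, ← hk]
  by_cases h : o.Parallel t y
  · rw [isPositive_iff (D := D.replace c r T o ho) (x := Sum.inr y) (i := t) h]
    exact iff_of_true Iff.rfl h
  · rw [isPositive_iff (D := D.replace c r T o ho) (x := Sum.inr y) (i := t + 1)
      (o.parallel_succ.2 h)]
    refine iff_of_false ?_ h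
    change ¬ (T.isOver (y, t + 1 + 1) = true ↔ T.isOver (y, t + 1) = true)
    rw [T.isOver_succ y (t + 1)]
    cases T.isOver (y, t + 1) <;> simp

/-- The sign to be kept is that of `c`, so that restriction preserves the difference across `c`
outside the tangle and the difference between the two sides inside it. -/
theorem isHomogeneous_replace_iff (hT : o.Resembles t) (hfl : o.Flows t)
    (hover : ∀ y, T.isOver (y, 0) = D.planeSign c r) :
    D.IsHomogeneous ↔ (D.replace c r T o ho).IsHomogeneous := by
  have hsub : ∀ h, D.IsSeifertInvariant h →
      h (c, t + r) - h (c, t + 2 + r) = h (c, 0) - h (c, 2) := fun h hh => by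
    rw [← hh.sub_add_two c (t + r), add_right_comm]
  have hsides : ∀ {h}, D.IsSeifertInvariant h →
      h (c, t + r) = h (c, t + 1 + r) ∧ h (c, t + 2 + r) = h (c, t + 3 + r) := by
    intro h hh
    have h0 := out_ne_of_flows ho hfl
    have h2 : D.out (c, t + r + 2) ≠ D.out (c, t + r + 2 + 1) := by
      rw [add_assoc (t + r), show (2 + 1 : Fin 4) = 3 from rfl, out_add_two, out_add_three]
      simpa using h0
    have e0 := hh.2 _ _ h0
    have e2 := hh.2 _ _ h2
    rw [add_right_comm t r, add_right_comm (t + 2) r, add_assoc t 2 1] at e2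
    rw [add_right_comm] at e0
    exact ⟨e0, e2⟩
  -- values at the ports are determined by those at two of them
  have hports : ∀ {h h'}, D.IsSeifertInvariant h → o.IsSeifertInvariant h' →
      h' (T.port t) = h (c, t + r) → h' (T.port (t + 2)) = h (c, t + 2 + r) →
      ∀ k, h' (T.port k) = h (c, k + r) := by
    intro h h' hh hh' h0 h2
    have a := hT.apply_eq h' hh'
    have b := hsides hh
    rw [Fin.forall_fin_four_add t]
    exact ⟨h0, by rw [← a.1, ← b.1, h0], h2, by rw [← a.2, ← b.2, h2]⟩
  rw [isHomogeneous_iff (D.IsPositive c), isHomogeneous_iff (D.IsPositive c)]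
  constructor
  · intro H h hh
    have hd := hh.diagram hT hfl
    have ht := hh.tangle
    obtain ⟨h₁, hh₁, h₁P, h₁N⟩ := H _ hd
    obtain ⟨k, hk, k0, k2, kP, kN⟩ := hT.exists_restrict _ ht
    have e := h₁P c Iff.rfl
    rw [← hsub _ hh₁, ← hsub _ hd] at e
    simp only [diagramEnd_self] at e
    -- The values outside and inside have the same difference between the two sides of `c`; a
    -- constant makes them agree at one end point, hence at all.
    have hinv := hk.add (Tangle.Orientation.isSeifertInvariant_const (h₁ (c, t + r) - k (T.port t)))
    refine ⟨replaceFun ho h₁ (k + fun _ => h₁ (c, t + r) - k (T.port t)),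
      isSeifertInvariant_replaceFun hh₁ hinv (hports hh₁ hinv ?_ ?_), ?_, ?_⟩
    · simp
    · simp only [Pi.add_apply, k0, k2]
      linear_combination e
    · rintro (x | y) hx
      · have := h₁P x.1 hx
        rwa [diagramEnd_of_ne x.2, diagramEnd_of_ne x.2] at this
      · have := kP y ((isPositive_inr_iff hfl hover y).1 hx)
        simpa [replaceFun, tangleEnd] using this
    · rintro (x | y) hx
      · exact h₁N x.1 hx
      · have := kN y (fun h => hx ((isPositive_inr_iff hfl hover y).2 h))
        simpa [replaceFun] using this
  · intro H h hh
    obtain ⟨k, hk, k0, k2⟩ := hT.exists_apply_eq (h (c, t + r)) (h (c, t + 2 + r))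
    obtain ⟨h₁, hh₁, h₁P, h₁N⟩ := H _
      (isSeifertInvariant_replaceFun (ho := ho) hh hk (hports hh hk k0 k2))
    have hd := hh₁.diagram hT hfl
    -- On the parallel crossings `h₁` and `k` have the same coboundary, so they have the same
    -- difference between the two sides. This is the required coboundary at `c`.
    have e := hT.apply_eq_of_parallel _ (hh₁.tangle.sub hk) fun y hy => by
      have : h₁ (tangleEnd ho (y, 0)) - h₁ (tangleEnd ho (y, 2)) = k (y, 0) - k (y, 2) :=
        h₁P (Sum.inr y) ((isPositive_inr_iff hfl hover y).2 hy)
      simp only [Pi.sub_apply]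
      linear_combination this
    simp only [Pi.sub_apply, k0, k2] at e
    refine ⟨_, hd, fun x hx => ?_, fun x hx => ?_⟩
    · by_cases hxc : x = c
      · subst hxc
        rw [← hsub _ hd, ← hsub _ hh, diagramEnd_self, diagramEnd_self]
        linear_combination e
      · rw [diagramEnd_of_ne hxc, diagramEnd_of_ne hxc]
        exact h₁P (Sum.inl ⟨x, hxc⟩) hx
    · have hxc : x ≠ c := fun h => hx (h ▸ Iff.rfl)
      rw [diagramEnd_of_ne hxc, diagramEnd_of_ne hxc]
      exact h₁N (Sum.inl ⟨x, hxc⟩) hx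

/-! ### Alternativity -/

/-- The edge of the enhanced checkerboard graph given by a crossing outside the tangle. -/
theorem touches_inl_iff (x : {x // x ≠ c}) (R : (D.replace c r T o ho).Region) :
    (D.replace c r T o ho).Touches (Sum.inl x) R ↔
      ∃ S, D.Touches x.1 S ∧ Quot.mk _ (Sum.inl S) = R := by
  constructor
  · rintro (h | h)
    · exact ⟨_, .inl rfl, h⟩
    · exact ⟨_, .inr rfl, h⟩
  · rintro ⟨S, rfl | rfl, h⟩
    · exact .inl h
    · exact .inr h

theorem touches_self_iff (ho : D.Fits c r T o) (hfl : o.Flows t) (R : D.Region) :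
    D.Touches c R ↔ D.region (c, t + 1 + r) = R ∨ D.region (c, t + 3 + r) = R := by
  rw [touches_iff (out_ne_of_flows ho hfl), add_right_comm, add_right_comm t r 3]

theorem isAlternative_of_replace (hT : o.Resembles t) (hfl : o.Flows t)
    (hover : ∀ y, T.isOver (y, 0) = D.planeSign c r)
    (h : (D.replace c r T o ho).IsAlternative) : (D.IsAlternative) := by
  rw [isAlternative_iff] at h ⊢
  have hF : T.IsRegionInvariant fun e =>
      (Quot.mk _ (Sum.inr e) : (D.replace c r T o ho).Region) :=
    fun e e' he => Quot.sound (RegionStep.inner e e' he)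
  -- A parallel crossing has the sign of `c` and can stand in for it at the region `R`.
  have hcorner : ∀ R, D.Touches c R → ∃ y, o.Parallel t y ∧
      (D.replace c r T o ho).Touches (Sum.inr y) (Quot.mk _ (Sum.inl R)) := by
    intro R hR
    obtain ⟨⟨y, hy, hyF⟩, z, hz, hzF⟩ := hT.exists_corner _ _ hF
    rw [touches_self_iff ho hfl] at hR
    rcases hR with rfl | rfl
    · refine ⟨y, hy, (touches_iff (D := D.replace c r T o ho) (x := Sum.inr y) (i := t) hy).2 ?_⟩
      rw [Quot.sound (RegionStep.left (t + 1))] at hyF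
      exact hyF
    · refine ⟨z, hz, (touches_iff (D := D.replace c r T o ho) (x := Sum.inr z) (i := t) hz).2 ?_⟩
      rw [Quot.sound (RegionStep.left (t + 3))] at hzF
      exact hzF
  have key : ∀ y R, y ≠ c → D.Touches c R → D.Touches y R →
      (D.IsPositive c ↔ D.IsPositive y) := by
    intro y R hy hc hyR
    obtain ⟨z, hz, hzR⟩ := hcorner R hc
    rw [← (isPositive_inr_iff (ho := ho) hfl hover z).2 hz]
    exact h _ (Sum.inl ⟨y, hy⟩) _ hzR ((touches_inl_iff _ _).2 ⟨R, hyR, rfl⟩)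
  intro x y R hx hy
  by_cases hxc : x = c
  · subst hxc
    by_cases hyc : y = x
    · rw [hyc]
    · exact key y R hyc hx hy
  · by_cases hyc : y = c
    · subst hyc
      exact (key x R hxc hy hx).symm
    · exact h (Sum.inl ⟨x, hxc⟩) (Sum.inl ⟨y, hyc⟩) _ ((touches_inl_iff _ _).2 ⟨R, hx, rfl⟩)
        ((touches_inl_iff _ _).2 ⟨R, hy, rfl⟩)

theorem IsAlternative.replace (hS : T.HasSides) (hL : T.HasLabelling t) (hfl : o.Flows t)
    (hover : ∀ y, T.isOver (y, 0) = D.planeSign c r) (hsame : D.SameType c r T o ho)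
    (h : D.IsAlternative) : ((D.replace c r T o ho).IsAlternative) := by
  classical
  rw [isAlternative_iff] at h ⊢
  -- the regions of `D`, with the two regions joined by the edge `c` identified
  let φ : D.Region → D.Region := fun R =>
    if R = D.region (c, t + 3 + r) then D.region (c, t + 1 + r) else R
  have hφ : ∀ R S, φ R = φ S → R = S ∨ (D.Touches c R ∧ D.Touches c S) := by
    intro R S
    simp only [φ, touches_self_iff ho hfl]
    split_ifs with h1 h2 h2
    · exact fun _ => .inl (h1.trans h2.symm)
    · exact fun e => .inr ⟨.inr h1.symm, .inl e⟩
    · exact fun e => .inr ⟨.inl e.symm, .inr h2.symm⟩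
    · exact fun e => .inl e
  have hφ1 : φ (D.region (c, t + 1 + r)) = D.region (c, t + 1 + r) := by simp [φ]
  have hφ3 : φ (D.region (c, t + 3 + r)) = D.region (c, t + 1 + r) := by simp [φ]
  obtain ⟨F, hF, F0, F1, F2, F3, hFx⟩ := hL D.Region (φ (D.region (c, t + r)))
    (φ (D.region (c, t + 2 + r))) (D.region (c, t + 1 + r))
  have hport : ∀ k, F (T.port k) = φ (D.region (c, k + r)) := by
    rw [Fin.forall_fin_four_add t]
    exact ⟨F0, F1.trans hφ1.symm, F2, F3.trans hφ3.symm⟩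
  -- The labelling of the tangle extends `φ`: the sides `t + 1` and `t + 3` are the ends of the edge
  -- `c`, and so carry the same label.
  let Φ : (D.replace c r T o ho).Region → D.Region := Quot.lift (Sum.elim φ F) (by
    rintro _ _ (⟨e, e', he⟩ | k | k)
    · exact hF e e' he
    · exact hport k
    · obtain ⟨k, rfl⟩ : ∃ j, k = j + 1 := ⟨k - 1, by simp⟩
      have : k + 1 + r - 1 = k + r := by rw [add_right_comm, add_sub_cancel_right]
      rw [this]
      exact (hS _ _ hF k).trans (hport k))
  have hin : ∀ y R, (D.replace c r T o ho).Touches (Sum.inr y) R →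
      Φ R = D.region (c, t + 1 + r) := by
    intro y R hy
    have hp := (isPositive_inr_iff hfl hover y).1 (hsame y)
    rw [touches_iff (D := D.replace c r T o ho) (x := Sum.inr y) (i := t) hp] at hy
    rcases hy with rfl | rfl
    · exact (hFx y).1
    · exact (hFx y).2
  have hcc : D.Touches c (D.region (c, t + 1 + r)) := (touches_self_iff ho hfl _).2 (.inl rfl)
  have key : ∀ x y R, (D.replace c r T o ho).Touches (Sum.inl x) R →
      (D.replace c r T o ho).Touches (Sum.inr y) R →
      ((D.replace c r T o ho).IsPositive (Sum.inl x) ↔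
        (D.replace c r T o ho).IsPositive (Sum.inr y)) := by
    intro x y R hx hy
    obtain ⟨S, hxS, rfl⟩ := (touches_inl_iff _ _).1 hx
    rw [hsame y]
    refine h x.1 c S hxS ?_
    rcases hφ S _ ((hin y _ hy).trans hφ1.symm) with e | e
    · rw [e]
      exact hcc
    · exact e.1
  rintro (x | x) (y | y) R hx hy
  · obtain ⟨S, hxS, rfl⟩ := (touches_inl_iff _ _).1 hx
    obtain ⟨S', hyS, hSS⟩ := (touches_inl_iff _ _).1 hy
    rcases hφ S S' (congr_arg Φ hSS).symm with rfl | ⟨e, e'⟩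
    · exact h x.1 y.1 S hxS hyS
    · exact (h x.1 c S hxS e).trans (h c y.1 S' e' hyS)
  · exact key x y R hx hy
  · exact (key y x R hy hx).symm
  · exact (hsame x).trans (hsame y).symm

end OrientedDiagram

theorem mainTheorem11 (D : OrientedDiagram) (hD : D.IsPlanar) (c : D.Crossing) (r : Fin 4)
    (b : TangleBlock) (hb : b.Extends (D.planeSign c r)) (o : b.toTangle.Orientation)
    (ho : D.Fits c r b.toTangle o) :
    (D.IsHomogeneous ↔ (D.replace c r b.toTangle o ho).IsHomogeneous) ∧
    ((D.replace c r b.toTangle o ho).IsAlternative → D.IsAlternative) ∧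
    (D.SameType c r b.toTangle o ho →
      (D.IsAlternative ↔ (D.replace c r b.toTangle o ho).IsAlternative)) := by
  have hover := TangleBlock.isOver_zero hb
  obtain ⟨hS, hadm⟩ := b.isAdmissible hb
  -- Opposite ends of `c` are oppositely oriented, which excludes the alternating case.
  obtain ⟨t, hfl⟩ : ∃ t, o.Flows t := by
    have h3 : ∀ k, o.out (b.toTangle.port (k + 2)) = !o.out (b.toTangle.port k) := fun k => by
      rw [ho, ho, ← D.out_opposite, add_right_comm]
    rcases (hadm o 0).cases with h | h | h
    · exact ⟨_, h⟩
    · exact ⟨_, h⟩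
    · exact absurd h.1 (by rw [h3]; simp)
  have hT := (hadm o t).resembles hfl
  have h2 := OrientedDiagram.isAlternative_of_replace (ho := ho) hT hfl hover
  exact ⟨OrientedDiagram.isHomogeneous_replace_iff hT hfl hover, h2, fun hsame =>
    ⟨fun h => h.replace hS (TangleBlock.hasLabelling hb t) hfl hover hsame, h2⟩⟩
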